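/- **Formulas.** Formulas of unit-free multiplicative linear logic are $A ::= X \mid X^\perp \mid A\otimes A \mid A\mathbin{⅋} A$, with $(\cdot)^\perp$ extended to all formulas by De Morgan duality. A *localized formula* is a formula each of whose syntactic constructs (atoms and connectives) carries a tag (*location*) from a fixed countably infinite set, no tag being used twice; it is an instance of the underlying untagged formula. Two localized formulas are *dual* if their underlying formulas are. A *sequent* is a finite set of localized formulas with pairwise disjoint sets of tags. **Proof structures.** A *proof structure* $\rho$ consists of finite sets of vertices and of edges, partial maps giving the source and the target of an edge, without directed cycle, together with a label $ax$, $cut$, $\otimes$ or $⅋$ on each vertex and a localized formula (its type) on each edge. A *premise* (*conclusion*) of a vertex is an edge with that vertex as target (source); a *premise* (*conclusion*) of $\rho$ is an edge without source (without target). An $ax$-vertex has no premise and two conclusions, of dual types; a $cut$-vertex has two premises, of dual types, and no conclusion; a $\otimes$-vertex (resp. $⅋$-vertex) has two premises, of types $A$ and $B$, and one conclusion, of type $A\otimes B$ (resp. $A\mathbin{⅋} B$). Tags are globally distinct: assign to each premise of $\rho$ and to each conclusion of an $ax$-vertex all the tags of its type, and to the conclusion of each $\otimes$- or $⅋$-vertex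 the tag of its outermost connective; the sets assigned to distinct edges are disjoint. A proof structure is *closed* if it has no premise. Isomorphisms preserve sources, targets, labels and types. **Proof nets.** Paths and cycles are taken in the underlying undirected graph; a path is $(v_0,e_1,v_1,\dots,e_n,v_n)$, where the endpoints of $e_i$ are exactly the two distinct vertices $v_{i-1},v_i$, and a *cycle* is such a path with $n\ge 1$, pairwise distinct edges, $v_0=v_n$ and $v_1,\dots,v_n$ pairwise distinct. A path is *switching* if it does not contain both premises of any $⅋$-vertex. A *proof net* is a proof structure without switching cycle. A vertex is *splitting* if it is an $ax$-, $cut$- or $\otimes$-vertex that lies on no cycle, or a $⅋$-vertex whose conclusion lies on no cycle. A *correctness graph* is obtained by making undefined, for each $⅋$-vertex, the target of one of its two premises. A proof net is *connected* if a correctness graph has exactly one connected component (an edge without endpoints counting as a component); the number of components does not depend on the correctness graph chosen. **Derivations.** Derivations of $\mathrm{MLL}^{0,2}_{hyp}$ are built with the rules $$\frac{}{\vdash A^\perp,A}\,(ax)\quad \frac{\vdash A,\Gamma\quad \vdash A^\perp,\Delta}{\vdash\Gamma,\Delta}\,(cut)\quad \frac{\vdash A,\Gamma\quad\vdash B,\Delta}{\vdash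 A\otimes B,\Gamma,\Delta}\,(\otimes)\quad \frac{\vdash A,B,\Gamma}{\vdash A\mathbin{⅋} B,\Gamma}\,(\mathbin{⅋})$$ $$\frac{\vdash\Gamma\quad\vdash\Delta}{\vdash\Gamma,\Delta}\,(mix_2)\qquad \frac{}{\vdash}\,(mix_0)\qquad \frac{}{\vdash A}\,(hyp)$$ where the two premises of a binary rule come from derivations with disjoint sets of tags, the two formulas of an axiom have disjoint sets of tags, and the tag of an introduced connective is new. The *desequentialization* $\mathcal D(\pi)$ is defined by induction: $(ax)$ gives an $ax$-vertex with two conclusions; $(hyp)$ gives a single edge without endpoints; $(mix_0)$ gives the empty graph; $(mix_2)$ gives the disjoint union; $(cut)$, resp. $(\otimes)$, adds to the disjoint union a $cut$-vertex, resp. a $\otimes$-vertex with a new conclusion edge, whose premises are the conclusions labeled by the active formulas; $(\mathbin{⅋})$ adds a $⅋$-vertex with a new conclusion edge in the same way. **Theorem.** Let $\rho$ be a proof net. 1. If $\rho$ has at least one vertex, then $\rho$ has a splitting vertex. 2. (Sequentialization) There is a derivation $\pi$ of $\mathrm{MLL}^{0,2}_{hyp}$ such that $\rho\simeq\mathcal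 D(\pi)$. 3. If $\rho$ is closed, then there is such a $\pi$ without $(hyp)$ rules. 4. If $\rho$ is connected, then there is such a $\pi$ without $(mix_0)$ and $(mix_2)$ rules. 5. If $\rho$ is closed and connected, then there is such a $\pi$ without $(hyp)$, $(mix_0)$ and $(mix_2)$ rules. -/

import Mathlib

/-! # Multiplicative proof nets with mix and hypotheses

Unit-free multiplicative linear logic (MLL), localized formulas, open derivations with mix rules,
proof structures as directed acyclic partial graphs, the Danos–Regnier criterion, and the
desequentialization of a derivation. -/

namespace ProofNet

/-! ## Formulas -/

/-- Unit-free MLL formulas over a type of propositional variables. -/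
inductive Formula (Atom : Type*) where
  | pos (X : Atom)
  | neg (X : Atom)
  | tensor (A B : Formula Atom)
  | parr (A B : Formula Atom)

/-- Linear negation, extended to all formulas by De Morgan duality. -/
def Formula.dual {Atom : Type*} : Formula Atom → Formula Atom
  | .pos X => .neg X
  | .neg X => .pos X
  | .tensor A B => .parr A.dual B.dual
  | .parr A B => .tensor A.dual B.dual

/-- Formulas in which every syntactic construct carries a tag (its location). Locations are natural
numbers. That no tag is repeated is the predicate `LFormula.WellTagged`. -/
inductive LFormula (Atom : Type*) where
  | pos (l : ℕ) (X : Atom)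
  | neg (l : ℕ) (X : Atom)
  | tensor (l : ℕ) (A B : LFormula Atom)
  | parr (l : ℕ) (A B : LFormula Atom)

namespace LFormula

variable {Atom : Type*}

/-- The underlying (untagged) formula. -/
def toFormula : LFormula Atom → Formula Atom
  | .pos _ X => .pos X
  | .neg _ X => .neg X
  | .tensor _ A B => .tensor A.toFormula B.toFormula
  | .parr _ A B => .parr A.toFormula B.toFormula

/-- The tag of the outermost construct. -/
def tag : LFormula Atom → ℕ
  | .pos l _ => l
  | .neg l _ => l
  | .tensor l _ _ => l
  | .parr l _ _ => l

/-- The set of all tags. -/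
def locs : LFormula Atom → Finset ℕ
  | .pos l _ => {l}
  | .neg l _ => {l}
  | .tensor l A B => insert l (A.locs ∪ B.locs)
  | .parr l A B => insert l (A.locs ∪ B.locs)

/-- No tag is used twice: the formula is a localized formula. -/
def WellTagged : LFormula Atom → Prop
  | .pos _ _ => True
  | .neg _ _ => True
  | .tensor l A B =>
      A.WellTagged ∧ B.WellTagged ∧ Disjoint A.locs B.locs ∧ l ∉ A.locs ∧ l ∉ B.locs
  | .parr l A B =>
      A.WellTagged ∧ B.WellTagged ∧ Disjoint A.locs B.locs ∧ l ∉ A.locs ∧ l ∉ B.locs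

/-- The underlying formulas are dual to each other. -/
def Dual (A B : LFormula Atom) : Prop := B.toFormula = A.toFormula.dual

end LFormula

/-! ## Directed partial graphs -/

/-- A directed partial graph: the source and the target of an edge may be undefined. -/
structure PartialGraph.{u} where
  V : Type u
  E : Type u
  src : E → Option V
  tgt : E → Option V

namespace PartialGraph

/-- The endpoints of the edge `e` are exactly the distinct vertices `u` and `w`
(orientation is forgotten). -/
def Joins (G : PartialGraph) (e : G.E) (u w : G.V) : Prop :=
  u ≠ w ∧ ((G.src e = some u ∧ G.tgt e = some w) ∨ (G.src e = some w ∧ G.tgt e = some u))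

/-- Undirected paths `(v₀, e₁, v₁, …, eₙ, vₙ)`. -/
inductive Path (G : PartialGraph) : G.V → G.V → Type _
  | nil (v : G.V) : Path G v v
  | cons {u v w : G.V} (e : G.E) (h : G.Joins e u v) (p : Path G v w) : Path G u w

namespace Path

variable {G : PartialGraph}

/-- The list `[v₀, v₁, …, vₙ]` of the vertices of a path. -/
def vertices : {u v : G.V} → Path G u v → List G.V
  | _, _, nil v => [v]
  | u, _, cons _ _ p => u :: p.vertices

/-- The list `[e₁, …, eₙ]` of the edges of a path. -/
def edges : {u v : G.V} → Path G u v → List G.E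
  | _, _, nil _ => []
  | _, _, cons e _ p => e :: p.edges

/-- A cycle is a non-empty simple closed path: its edges are pairwise distinct, and so are its
vertices, except that the two endpoints are equal. -/
def IsCycle {v : G.V} (p : Path G v v) : Prop :=
  p.edges ≠ [] ∧ p.edges.Nodup ∧ p.vertices.tail.Nodup

end Path

/-- No directed cycle. -/
def DirectedAcyclic (G : PartialGraph) : Prop :=
  ∀ v, ¬ Relation.TransGen (fun u w => ∃ e, G.src e = some u ∧ G.tgt e = some w) v v

/-- Incidence between vertices and edges. -/
def Incident (G : PartialGraph) : G.V ⊕ G.E → G.V ⊕ G.E → Prop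
  | .inl v, .inr e => G.src e = some v ∨ G.tgt e = some v
  | _, _ => False

/-- The number of connected components. Both vertices and edges are taken into account: an edge
without endpoint forms a component of its own. -/
noncomputable def numComponents (G : PartialGraph) : ℕ := Nat.card (Quot G.Incident)

open Classical in
/-- The graph obtained by making the target of every edge of `S` undefined. -/
@[reducible] noncomputable def disconnect (G : PartialGraph) (S : Set G.E) : PartialGraph where
  V := G.V
  E := G.E
  src := G.src
  tgt e := if e ∈ S then none else G.tgt e

end PartialGraph

/-! ## Proof structures -/

/-- The labels of vertices. -/
inductive Rule where
  | ax
  | cut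
  | tensor
  | parr

/-- A directed partial graph whose vertices are labeled with rules and whose edges are labeled with
(tagged) formulas, called their types. -/
structure LabeledGraph.{u, v} (Atom : Type u) extends PartialGraph.{v} where
  rule : V → Rule
  type : E → LFormula Atom

namespace LabeledGraph

variable {Atom : Type*}

/-- The premises of a vertex. -/
def premises (ρ : LabeledGraph Atom) (v : ρ.V) : Set ρ.E := {e | ρ.tgt e = some v}

/-- The conclusions of a vertex. -/
def conclusions (ρ : LabeledGraph Atom) (v : ρ.V) : Set ρ.E := {e | ρ.src e = some v}

/-- The arity and typing constraints at the vertex `v`. -/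
def LocalConstraint (ρ : LabeledGraph Atom) (v : ρ.V) : Prop :=
  match ρ.rule v with
  | .ax => ρ.premises v = ∅ ∧
      ∃ e f, e ≠ f ∧ ρ.conclusions v = {e, f} ∧ (ρ.type e).Dual (ρ.type f)
  | .cut => ρ.conclusions v = ∅ ∧
      ∃ e f, e ≠ f ∧ ρ.premises v = {e, f} ∧ (ρ.type e).Dual (ρ.type f)
  | .tensor => ∃ e f c l, e ≠ f ∧ ρ.premises v = {e, f} ∧ ρ.conclusions v = {c} ∧
      ρ.type c = .tensor l (ρ.type e) (ρ.type f)
  | .parr => ∃ e f c l, e ≠ f ∧ ρ.premises v = {e, f} ∧ ρ.conclusions v = {c} ∧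
      ρ.type c = .parr l (ρ.type e) (ρ.type f)

/-- An initial edge is a premise of the structure or a conclusion of an `ax`-vertex. -/
def IsInitial (ρ : LabeledGraph Atom) (e : ρ.E) : Prop :=
  ρ.src e = none ∨ ∃ v, ρ.src e = some v ∧ ρ.rule v = .ax

/-- The locations that make their first appearance at the edge `e`: all those of its type if `e` is
initial, and only the tag of the outermost connective if `e` is the conclusion of a `⊗`- or
`⅋`-vertex. -/
def newLocs (ρ : LabeledGraph Atom) (e : ρ.E) : Set ℕ :=
  {l | l = (ρ.type e).tag ∨ (ρ.IsInitial e ∧ l ∈ (ρ.type e).locs)}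

/-- Proof structures (possibly open, that is, with premises). -/
structure IsProofStructure (ρ : LabeledGraph Atom) : Prop where
  finite_V : Finite ρ.V
  finite_E : Finite ρ.E
  acyclic : ρ.DirectedAcyclic
  local_constraint : ∀ v, ρ.LocalConstraint v
  wellTagged : ∀ e, (ρ.type e).WellTagged
  disjoint_locs : ∀ e f, e ≠ f → Disjoint (ρ.newLocs e) (ρ.newLocs f)

/-- A set of edges that contains two distinct premises of no `⅋`-vertex. -/
def SwitchingEdges (ρ : LabeledGraph Atom) (es : List ρ.E) : Prop :=
  ∀ v, ρ.rule v = .parr → ∀ e f, e ∈ ρ.premises v → f ∈ ρ.premises v → e ≠ f →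
    ¬ (e ∈ es ∧ f ∈ es)

/-- Danos–Regnier correctness: there is no switching cycle. -/
def DRCorrect (ρ : LabeledGraph Atom) : Prop :=
  ∀ (v : ρ.V) (p : ρ.toPartialGraph.Path v v), p.IsCycle → ¬ ρ.SwitchingEdges p.edges

/-- A proof net is a Danos–Regnier correct proof structure. -/
structure IsProofNet (ρ : LabeledGraph Atom) : Prop where
  isProofStructure : ρ.IsProofStructure
  drCorrect : ρ.DRCorrect

/-- A splitting vertex: an `ax`-, `cut`- or `⊗`-vertex that is in no cycle, or a `⅋`-vertex whose
conclusion is in no cycle. -/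
def IsSplitting (ρ : LabeledGraph Atom) (v : ρ.V) : Prop :=
  (ρ.rule v ≠ .parr ∧
    ∀ (u : ρ.V) (p : ρ.toPartialGraph.Path u u), p.IsCycle → v ∉ p.vertices) ∨
  (ρ.rule v = .parr ∧ ∀ e ∈ ρ.conclusions v,
    ∀ (u : ρ.V) (p : ρ.toPartialGraph.Path u u), p.IsCycle → e ∉ p.edges)

/-- A structure is closed if it has no premise. -/
def IsClosed (ρ : LabeledGraph Atom) : Prop := ∀ e, ρ.src e ≠ none

/-- `S` consists of exactly one premise of every `⅋`-vertex. -/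
def IsChoice (ρ : LabeledGraph Atom) (S : Set ρ.E) : Prop :=
  (∀ e ∈ S, ∃ v, ρ.rule v = .parr ∧ e ∈ ρ.premises v) ∧
  ∀ v, ρ.rule v = .parr → ∃! e, e ∈ S ∧ e ∈ ρ.premises v

/-- Connectedness of proof nets: a correctness graph, which is obtained by disconnecting one premise
of every `⅋`-vertex, has exactly one connected component. In a proof net all correctness graphs have
the same number of components. -/
def IsConnected (ρ : LabeledGraph Atom) : Prop :=
  ∃ S, ρ.IsChoice S ∧ (ρ.toPartialGraph.disconnect S).numComponents = 1

/-- Isomorphisms preserve sources, targets, rules and types. -/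
structure Iso (ρ σ : LabeledGraph Atom) where
  onV : ρ.V ≃ σ.V
  onE : ρ.E ≃ σ.E
  src_eq : ∀ e, σ.src (onE e) = (ρ.src e).map onV
  tgt_eq : ∀ e, σ.tgt (onE e) = (ρ.tgt e).map onV
  rule_eq : ∀ v, σ.rule (onV v) = ρ.rule v
  type_eq : ∀ e, σ.type (onE e) = ρ.type e

/-! ### Constructions on labeled graphs -/

/-- The empty graph. -/
@[reducible] def empty : LabeledGraph Atom where
  V := Empty
  E := Empty
  src := Empty.elim
  tgt := Empty.elim
  rule := Empty.elim
  type := Empty.elim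

/-- A single edge with no endpoint. -/
@[reducible] def singleEdge (A : LFormula Atom) : LabeledGraph Atom where
  V := Empty
  E := Unit
  src _ := none
  tgt _ := none
  rule := Empty.elim
  type _ := A

/-- A single `ax`-vertex with two conclusions. -/
@[reducible] def axiomLink (A B : LFormula Atom) : LabeledGraph Atom where
  V := Unit
  E := Bool
  src _ := some ()
  tgt _ := none
  rule _ := .ax
  type b := if b then A else B

/-- Disjoint union. -/
@[reducible] def disjUnion (ρ σ : LabeledGraph Atom) : LabeledGraph Atom where
  V := ρ.V ⊕ σ.V
  E := ρ.E ⊕ σ.E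
  src := Sum.elim (fun e => (ρ.src e).map .inl) (fun e => (σ.src e).map .inr)
  tgt := Sum.elim (fun e => (ρ.tgt e).map .inl) (fun e => (σ.tgt e).map .inr)
  rule := Sum.elim ρ.rule σ.rule
  type := Sum.elim ρ.type σ.type

open Classical in
/-- Add a new `cut`-vertex (`none`), which becomes the target of the conclusions of the structure
that are labeled `A` or `B`. -/
@[reducible] noncomputable def addCut (ρ : LabeledGraph Atom) (A B : LFormula Atom) : LabeledGraph Atom where
  V := Option ρ.V
  E := ρ.E
  src e := (ρ.src e).map some
  tgt e := if ρ.tgt e = none ∧ (ρ.type e = A ∨ ρ.type e = B) then some none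
    else (ρ.tgt e).map some
  rule v := v.elim .cut ρ.rule
  type := ρ.type

open Classical in
/-- Add a new vertex (`none`) with label `r`, which becomes the target of the conclusions of the
structure that are labeled `A` or `B`, and a new edge (`none`) of type `C` without target whose
source is the new vertex. -/
@[reducible] noncomputable def addLink (ρ : LabeledGraph Atom) (r : Rule) (A B C : LFormula Atom) :
    LabeledGraph Atom where
  V := Option ρ.V
  E := Option ρ.E
  src o := o.elim (some none) fun e => (ρ.src e).map some
  tgt o := o.elim none fun e =>
    if ρ.tgt e = none ∧ (ρ.type e = A ∨ ρ.type e = B) then some none else (ρ.tgt e).map some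
  rule v := v.elim r ρ.rule
  type o := o.elim C ρ.type

end LabeledGraph

/-! ## Derivations -/

/-- Trees of rules of MLL with hypotheses and mix. The arguments `A B` are the conclusions of an
axiom and the active formulas of the other rules, and `l` is the tag of the connective introduced by
the rule. Such a tree is a derivation when it satisfies `DerivationTree.IsDerivation`. -/
inductive DerivationTree (Atom : Type*) where
  | ax (A B : LFormula Atom)
  | cut (A B : LFormula Atom) (π₁ π₂ : DerivationTree Atom)
  | tensor (l : ℕ) (A B : LFormula Atom) (π₁ π₂ : DerivationTree Atom)
  | parr (l : ℕ) (A B : LFormula Atom) (π : DerivationTree Atom)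
  | mix₂ (π₁ π₂ : DerivationTree Atom)
  | mix₀
  | hyp (A : LFormula Atom)

namespace DerivationTree

variable {Atom : Type*}

/-- The conclusion sequent, a set of localized formulas. -/
def concl : DerivationTree Atom → Set (LFormula Atom)
  | .ax A B => {A, B}
  | .cut A B π₁ π₂ => (π₁.concl \ {A}) ∪ (π₂.concl \ {B})
  | .tensor l A B π₁ π₂ => {.tensor l A B} ∪ (π₁.concl \ {A}) ∪ (π₂.concl \ {B})
  | .parr l A B π => {.parr l A B} ∪ (π.concl \ {A, B})
  | .mix₂ π₁ π₂ => π₁.concl ∪ π₂.concl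
  | .mix₀ => ∅
  | .hyp A => {A}

/-- All the locations used in a derivation. -/
def locs : DerivationTree Atom → Finset ℕ
  | .ax A B => A.locs ∪ B.locs
  | .cut _ _ π₁ π₂ => π₁.locs ∪ π₂.locs
  | .tensor l _ _ π₁ π₂ => insert l (π₁.locs ∪ π₂.locs)
  | .parr l _ _ π => insert l π.locs
  | .mix₂ π₁ π₂ => π₁.locs ∪ π₂.locs
  | .mix₀ => ∅
  | .hyp A => A.locs

/-- Correct application of all rules, with pairwise distinct locations throughout. -/
def IsDerivation : DerivationTree Atom → Prop
  | .ax A B => A.Dual B ∧ A.WellTagged ∧ B.WellTagged ∧ Disjoint A.locs B.locs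
  | .cut A B π₁ π₂ => π₁.IsDerivation ∧ π₂.IsDerivation ∧ Disjoint π₁.locs π₂.locs ∧
      A ∈ π₁.concl ∧ B ∈ π₂.concl ∧ A.Dual B
  | .tensor l A B π₁ π₂ => π₁.IsDerivation ∧ π₂.IsDerivation ∧ Disjoint π₁.locs π₂.locs ∧
      A ∈ π₁.concl ∧ B ∈ π₂.concl ∧ l ∉ π₁.locs ∪ π₂.locs
  | .parr l A B π => π.IsDerivation ∧ A ∈ π.concl ∧ B ∈ π.concl ∧ A ≠ B ∧ l ∉ π.locs
  | .mix₂ π₁ π₂ => π₁.IsDerivation ∧ π₂.IsDerivation ∧ Disjoint π₁.locs π₂.locs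
  | .mix₀ => True
  | .hyp A => A.WellTagged

/-- The `hyp` rule is not used. -/
def HypFree : DerivationTree Atom → Prop
  | .ax _ _ => True
  | .cut _ _ π₁ π₂ => π₁.HypFree ∧ π₂.HypFree
  | .tensor _ _ _ π₁ π₂ => π₁.HypFree ∧ π₂.HypFree
  | .parr _ _ _ π => π.HypFree
  | .mix₂ π₁ π₂ => π₁.HypFree ∧ π₂.HypFree
  | .mix₀ => True
  | .hyp _ => False

/-- Neither of the two mix rules is used. -/
def MixFree : DerivationTree Atom → Prop
  | .ax _ _ => True
  | .cut _ _ π₁ π₂ => π₁.MixFree ∧ π₂.MixFree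
  | .tensor _ _ _ π₁ π₂ => π₁.MixFree ∧ π₂.MixFree
  | .parr _ _ _ π => π.MixFree
  | .mix₂ _ _ => False
  | .mix₀ => False
  | .hyp _ => True

/-- Desequentialization. In a derivation the locations of `π₁` and `π₂` are disjoint, so that in the
disjoint union the only conclusions labeled `A` or `B` are the conclusion of the first structure
labeled `A` and the conclusion of the second one labeled `B`. -/
noncomputable def deseq : DerivationTree Atom → LabeledGraph.{_, 0} Atom
  | .ax A B => .axiomLink A B
  | .cut A B π₁ π₂ => (π₁.deseq.disjUnion π₂.deseq).addCut A B
  | .tensor l A B π₁ π₂ =>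
      (π₁.deseq.disjUnion π₂.deseq).addLink .tensor A B (.tensor l A B)
  | .parr l A B π => π.deseq.addLink .parr A B (.parr l A B)
  | .mix₂ π₁ π₂ => π₁.deseq.disjUnion π₂.deseq
  | .mix₀ => .empty
  | .hyp A => .singleEdge A

end DerivationTree

end ProofNet

/-! The heart of the matter is a splitting vertex that is moreover terminal: none of its conclusions
has a target (`exists_terminal_splitting`). It is obtained by an argument in the style of Yeo's
theorem, in the incidence graph, whose nodes are the vertices and the edges of the net. Around each
vertex the edges are coloured so that the premises of a ⅋-vertex share a colour and any other two
edges differ; passing through a vertex by two edges of one colour is a cusp. Correctness then says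
that every cycle has a cusp, its base point included (`DRCorrect.cusps_ne_zero`).

A state is a vertex with one of its premises. The state (v, a) hops to (u, e) if some cusp-free path
leaves v with a colour other than that of a and reaches u through e, while no cusp-free path leaving
u with a colour other than that of e comes back to it. The no-return clause makes `Hop` a strict
order (`Hop.trans`, `Hop.irrefl`), so by finiteness there is a maximal state (v, a) as soon as there
is a state. If v were on a cycle without cusp at v, `exists_hop` would give a larger state: in such
a cycle with fewest cusps take the first cusp u; a return path from u could be exchanged with pieces
of the cycle to give fewer cusps, or a cycle with none. So v is splitting, and its conclusions are
on no cycle. A conclusion with a target would itself be a hop (`exists_hop_of_conclusion`), so v is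
terminal.

Sequentialization is an induction on the number of vertices and edges. A graph with several
components ends with `mix₂`; a single component without vertex is a hypothesis, and the empty graph
is `mix₀`; otherwise a terminal splitting vertex gives the last rule. For a cut or a ⊗ the two
premises fall in separate parts (`IsSplitting.exists_isSplit`). The induction carries
`Sequentializes`: the conclusions and locations of the derivation are controlled, as the side
conditions of the rules require, and the same derivation avoids `hyp` if the net is closed and mix
if it is connected. One derivation thus serves all the items. -/

namespace ProofNet

/-! ### Cusps of paths in a locally coloured graph. -/

namespace Trail

variable {N : Type*}

theorem exists_first {α : Type*} (p : α → Prop) : ∀ L : List α, (∃ x ∈ L, p x) →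
    ∃ L₁ x L₂, L = L₁ ++ x :: L₂ ∧ p x ∧ ∀ z ∈ L₁, ¬ p z
  | [], h => by simp at h
  | a :: L, h => by
    by_cases ha : p a
    · exact ⟨[], a, L, rfl, ha, by simp⟩
    · obtain ⟨L₁, x, L₂, rfl, hx, h₁⟩ := exists_first p L (by simpa [ha] using h)
      exact ⟨a :: L₁, x, L₂, rfl, hx, by simpa [ha] using h₁⟩

open Classical in
/-- Whether the passage through `y` from `o₁` to `o₂` is a cusp, that is, uses a single colour. -/
noncomputable def cuspAt (κ : N → N → N) (o₁ : Option N) (y : N) (o₂ : Option N) : ℕ :=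
  if ∃ a ∈ o₁, ∃ c ∈ o₂, κ y a = κ y c then 1 else 0

/-- The number of cusps of a list of nodes. -/
noncomputable def cusps (κ : N → N → N) : List N → ℕ
  | [] => 0
  | [_] => 0
  | a :: b :: l => cuspAt κ (some a) b l.head? + cusps κ (b :: l)

variable {κ : N → N → N}

theorem cuspAt_comm (o₁ : Option N) (y : N) (o₂ : Option N) :
    cuspAt κ o₁ y o₂ = cuspAt κ o₂ y o₁ := by
  unfold cuspAt
  congr 1
  apply propext
  constructor <;> rintro ⟨a, ha, c, hc, h⟩ <;> exact ⟨c, hc, a, ha, h.symm⟩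

theorem cuspAt_eq_zero {o₁ : Option N} {y : N} {o₂ : Option N} :
    cuspAt κ o₁ y o₂ = 0 ↔ ∀ a ∈ o₁, ∀ c ∈ o₂, κ y a ≠ κ y c := by
  simp [cuspAt]

theorem cuspAt_le_one (o₁ : Option N) (y : N) (o₂ : Option N) : cuspAt κ o₁ y o₂ ≤ 1 := by
  unfold cuspAt; split_ifs <;> simp

@[simp] theorem cuspAt_none_left (y : N) (o : Option N) : cuspAt κ none y o = 0 := by
  simp [cuspAt]

@[simp] theorem cuspAt_none_right (y : N) (o : Option N) : cuspAt κ o y none = 0 := by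
  simp [cuspAt]

@[simp] theorem cusps_singleton (a : N) : cusps κ [a] = 0 := rfl

@[simp] theorem cusps_pair (a b : N) : cusps κ [a, b] = 0 := by simp [cusps]

theorem cusps_append (y : N) (Z : List N) : ∀ X : List N,
    cusps κ (X ++ y :: Z) = cusps κ (X ++ [y]) + cuspAt κ X.getLast? y Z.head? + cusps κ (y :: Z)
  | [] => by simp
  | [a] => by simp [cusps]
  | a :: b :: X => by
    have := cusps_append y Z (b :: X)
    simp only [List.cons_append, cusps, List.getLast?_cons_cons] at this ⊢
    rw [this]
    cases X <;> simp [add_assoc]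

theorem cusps_reverse : ∀ l : List N, cusps κ l.reverse = cusps κ l
  | [] => rfl
  | [_] => rfl
  | a :: b :: l => by
    have h := cusps_reverse (b :: l)
    simp only [List.reverse_cons, List.append_assoc, List.singleton_append, cusps] at h ⊢
    rw [cusps_append, h, cuspAt_comm]
    simp [add_comm]

theorem exists_first_cusp (w : N) : ∀ (l : List N) (v : N), cusps κ (v :: l ++ [w]) ≠ 0 →
    ∃ A u B, l = A ++ u :: B ∧ cusps κ (v :: A ++ [u]) = 0 ∧
      cuspAt κ (v :: A).getLast? u (B ++ [w]).head? = 1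
  | [], v, h => by simp at h
  | x :: l, v, h => by
    by_cases hx : cuspAt κ (some v) x (l ++ [w]).head? = 0
    · obtain ⟨A, u, B, rfl, h₁, h₂⟩ := exists_first_cusp w l x (by
        intro h'
        apply h
        simp only [List.cons_append, cusps] at h' ⊢
        rw [hx, h'])
      refine ⟨x :: A, u, B, rfl, ?_, by simpa using h₂⟩
      simp only [List.cons_append, cusps] at h₁ ⊢
      rw [h₁]
      cases A <;> simpa using hx
    · have := cuspAt_le_one (κ := κ) (some v) x (l ++ [w]).head?
      exact ⟨[], x, l, rfl, by simp, by simp only [List.getLast?_singleton]; omega⟩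

/-! ### Cycles, good paths and the hop order. -/

/-- `x :: l ++ [x]` is a cycle. -/
structure IsCyc (Adj : N → N → Prop) (x : N) (l : List N) : Prop where
  chain : (x :: l ++ [x]).IsChain Adj
  nodup : (x :: l).Nodup
  two_le : 2 ≤ l.length

/-- A cusp-free path from `v` to `u` which does not start with the colour of `a` at `v` and whose
last step is from `e` to `u`. -/
structure GoodPath (Adj : N → N → Prop) (κ : N → N → N) (v a : N) (A : List N) (u e : N) : Prop where
  chain : (v :: A ++ [u]).IsChain Adj
  nodup : (v :: A ++ [u]).Nodup
  cusps_eq : cusps κ (v :: A ++ [u]) = 0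
  start : ∀ b ∈ (A ++ [u]).head?, κ v a ≠ κ v b
  last : (v :: A).getLast? = some e

/-- There is a good path along which no good path comes back. -/
def Hop (Adj : N → N → Prop) (κ : N → N → N) (s t : N × N) : Prop :=
  ∃ A, GoodPath Adj κ s.1 s.2 A t.1 t.2 ∧
    ∀ R y f, GoodPath Adj κ t.1 t.2 R y f → y ∉ s.1 :: A

variable {Adj : N → N → Prop}

theorem GoodPath.prefix {v a u e : N} {A B : List N} {x : N}
    (h : GoodPath Adj κ v a (A ++ x :: B) u e) : ∃ f, GoodPath Adj κ v a A x f := by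
  have e₁ : v :: (A ++ x :: B) ++ [u] = (v :: A ++ [x]) ++ (B ++ [u]) := by simp
  have e₂ : v :: (A ++ x :: B) ++ [u] = v :: A ++ x :: (B ++ [u]) := by simp
  refine ⟨(v :: A).getLast (by simp), ?_, ?_, ?_, ?_, List.getLast?_eq_some_getLast _⟩
  · exact (e₁ ▸ h.chain).left_of_append
  · exact (List.nodup_append.1 (e₁ ▸ h.nodup)).1
  · have := h.cusps_eq
    rw [e₂, cusps_append] at this
    omega
  · have := h.start
    cases A <;> simpa using this

/-- No cusp arises at the junction `u`: the first path arrives from `e`, and the second one avoids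
the colour of `e` at `u`. -/
theorem GoodPath.append {v a u e w f : N} {A B : List N}
    (h₁ : GoodPath Adj κ v a A u e) (h₂ : GoodPath Adj κ u e B w f)
    (h : ∀ x ∈ B ++ [w], x ∉ v :: A) : GoodPath Adj κ v a (A ++ u :: B) w f := by
  have e₂ : v :: (A ++ u :: B) ++ [w] = v :: A ++ u :: (B ++ [w]) := by simp
  refine ⟨?_, ?_, ?_, ?_, ?_⟩
  · rw [e₂]; exact List.isChain_split.2 ⟨h₁.chain, h₂.chain⟩
  · have e₃ : v :: (A ++ u :: B) ++ [w] = (v :: A ++ [u]) ++ (B ++ [w]) := by simp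
    rw [e₃, List.nodup_append']
    refine ⟨h₁.nodup, (List.nodup_cons.1 h₂.nodup).2, ?_⟩
    intro x hx hx'
    rcases List.mem_append.1 hx with hx | hx
    · exact h x hx' hx
    · rw [List.mem_singleton] at hx
      subst hx
      exact (List.nodup_cons.1 h₂.nodup).1 hx'
  · have h₃ := h₁.cusps_eq
    have h₄ := h₂.cusps_eq
    rw [e₂, cusps_append, h₃]
    rw [List.cons_append] at h₄
    rw [h₄, cuspAt_eq_zero.2]
    rw [h₁.last]
    rintro _ ⟨⟩
    exact h₂.start
  · have := h₁.start
    cases A <;> simpa using this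
  · have := h₂.last
    simpa [List.getLast?_append, List.getLast?_cons] using this

/-- A good path meeting a set of nodes has a prefix whose end is its first node in this set. -/
theorem GoodPath.exists_prefix {v a u e : N} {A : List N} (h : GoodPath Adj κ v a A u e)
    (p : N → Prop) (hp : ∃ x ∈ A ++ [u], p x) :
    ∃ B x f, GoodPath Adj κ v a B x f ∧ p x ∧ ∀ z ∈ B, ¬ p z := by
  obtain ⟨L₁, x, L₂, hL, hx, h₁⟩ := exists_first p _ hp
  rcases List.eq_nil_or_concat L₂ with rfl | ⟨L₃, b, rfl⟩
  · obtain ⟨rfl, rfl⟩ : A = L₁ ∧ u = x := by simpa using hL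
    exact ⟨A, u, e, h, hx, h₁⟩
  · obtain ⟨rfl, rfl⟩ : A = L₁ ++ x :: L₃ ∧ u = b := by
      have : A ++ [u] = (L₁ ++ x :: L₃) ++ [b] := by simpa using hL
      exact List.append_inj' this rfl |>.imp_right (by simp)
    obtain ⟨f, hf⟩ := h.prefix
    exact ⟨L₁, x, f, hf, hx, h₁⟩

/-- If the second path met the first, its prefix up to there would be a return forbidden by the
first hop, so the two paths concatenate. A return to the composite cannot touch the second path;
appended to that path, it would be a return to the first. -/
theorem Hop.trans {s t r : N × N} (h₁ : Hop Adj κ s t) (h₂ : Hop Adj κ t r) : Hop Adj κ s r := by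
  obtain ⟨A, hA, hA'⟩ := h₁
  obtain ⟨B, hB, hB'⟩ := h₂
  have hdisj : ∀ x ∈ B ++ [r.1], x ∉ s.1 :: A := by
    intro x hx hx'
    obtain ⟨C, y, f, hC, rfl, -⟩ := hB.exists_prefix (· = x) ⟨x, hx, rfl⟩
    exact hA' _ _ _ hC hx'
  refine ⟨A ++ t.1 :: B, hA.append hB hdisj, ?_⟩
  intro R y f hR hy
  have hR' : ∀ x ∈ R ++ [y], x ∉ t.1 :: B := by
    intro x hx hx'
    obtain ⟨C, z, f, hC, rfl, -⟩ := hR.exists_prefix (· = x) ⟨x, hx, rfl⟩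
    exact hB' _ _ _ hC hx'
  have hy' : y ∈ s.1 :: A := by
    have : y ∈ (s.1 :: A) ++ (t.1 :: B) := by simpa using hy
    rcases List.mem_append.1 this with h | h
    · exact h
    · exact absurd h (hR' y (by simp))
  exact hA' _ _ _ (hB.append hR hR') hy'

theorem Hop.irrefl (s : N × N) : ¬ Hop Adj κ s s := by
  rintro ⟨A, hA, -⟩
  have := hA.nodup
  simp at this

theorem exists_maximal [Finite N] (T : Set (N × N)) (hT : T.Nonempty) :
    ∃ s ∈ T, ∀ t ∈ T, ¬ Hop Adj κ s t := by
  let r : N × N → N × N → Prop := fun a b => Hop Adj κ b a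
  have : IsTrans _ r := ⟨fun _ _ _ h₁ h₂ => Hop.trans h₂ h₁⟩
  have : Std.Irrefl r := ⟨Hop.irrefl⟩
  exact (Finite.wellFounded_of_trans_of_irrefl r).has_min T hT

/-- The chord `R` leaves the cycle at `u` and lands at `x` before `u`. One new cycle closes the
chord along `A₂`, the other replaces `A₂` by the reversed chord. -/
theorem nodup_shortcut_left {A₁ A₂ B R : List N} {x u : N} (h₁ : (u :: R ++ [x]).Nodup)
    (h₂ : (A₁ ++ x :: A₂ ++ u :: B).Nodup) (h₃ : ∀ z ∈ R, z ∉ A₁ ++ x :: A₂ ++ B) :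
    (u :: (R ++ x :: A₂)).Nodup ∧ (A₁ ++ x :: (R.reverse ++ u :: B)).Nodup := by
  simp only [List.nodup_append, List.nodup_cons, List.cons_append, List.mem_append, List.mem_cons,
    List.nodup_reverse, List.mem_reverse] at *
  grind

/-- Here the chord lands after `u`. One new cycle replaces `B₁` by the chord, the other closes the
chord along the reversed `B₁`. -/
theorem nodup_shortcut_right {A B₁ B₂ R : List N} {x u : N} (h₁ : (u :: R ++ [x]).Nodup)
    (h₂ : (A ++ u :: (B₁ ++ x :: B₂)).Nodup) (h₃ : ∀ z ∈ R, z ∉ A ++ (B₁ ++ x :: B₂)) :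
    (A ++ u :: (R ++ x :: B₂)).Nodup ∧ (u :: (R ++ x :: B₁.reverse)).Nodup := by
  simp only [List.nodup_append, List.nodup_cons, List.cons_append, List.mem_append, List.mem_cons,
    List.nodup_reverse, List.mem_reverse] at *
  grind

/-! ### The exchange argument. -/

/-- A cycle through `v` without cusp at `v`, which does not start with the colour of `a`, gives
rise to a hop from `v` to some node `u` that is a cusp of some cycle. -/
theorem exists_hop (hsymm : ∀ x y, Adj x y → Adj y x) (D : Set N)
    (hD : ∀ x a c, κ x a = κ x c → a ≠ c → x ∈ D)
    (H : ∀ v ∈ D, ∀ l, IsCyc Adj v l → (∀ b ∈ l.head?, ∀ z ∈ l.getLast?, κ v b ≠ κ v z) →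
      cusps κ (v :: l ++ [v]) ≠ 0)
    {v a : N} (hv : v ∈ D) {l₀ : List N} (hl₀ : IsCyc Adj v l₀)
    (hs₀ : ∀ b ∈ l₀.head?, κ v a ≠ κ v b ∧ ∀ z ∈ l₀.getLast?, κ v z ≠ κ v b) :
    ∃ u e f, Hop Adj κ (v, a) (u, e) ∧ Adj e u ∧ e ≠ f ∧ κ u e = κ u f := by
  let S : Set (List N) := {l | IsCyc Adj v l ∧
    ∀ b ∈ l.head?, κ v a ≠ κ v b ∧ ∀ z ∈ l.getLast?, κ v z ≠ κ v b}
  obtain ⟨l, ⟨hl, hs⟩, hmin⟩ :=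
    (measure fun l => cusps κ (v :: l ++ [v])).wf.has_min S ⟨l₀, hl₀, hs₀⟩
  replace hmin : ∀ l' ∈ S, cusps κ (v :: l ++ [v]) ≤ cusps κ (v :: l' ++ [v]) :=
    fun l' h => not_lt.1 (hmin l' h)
  -- The cycle `l` has as few cusps as possible in `S`; by `H` it still has one, and `u` is the
  -- first.
  obtain ⟨A, u, B, rfl, hA0, hcusp⟩ := exists_first_cusp v l v (H v hv l hl
    fun b hb z hz => ((hs b hb).2 z hz).symm)
  obtain ⟨e, he⟩ : ∃ e, (v :: A).getLast? = some e := ⟨_, List.getLast?_eq_some_getLast (by simp)⟩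
  obtain ⟨g, hg⟩ : ∃ g, (B ++ [v]).head? = some g := ⟨_, List.head?_eq_some_head (by simp)⟩
  have hω : v :: (A ++ u :: B) ++ [v] = v :: A ++ u :: (B ++ [v]) := by simp
  have hcω : cusps κ (v :: (A ++ u :: B) ++ [v]) = 1 + cusps κ (u :: (B ++ [v])) := by
    rw [hω, cusps_append, hA0, hcusp, zero_add]
  have hchain := hl.chain
  rw [hω, List.isChain_split] at hchain
  have heg : κ u e = κ u g := by
    by_contra h
    have : cuspAt κ (v :: A).getLast? u (B ++ [v]).head? = 0 := by
      rw [he, hg, cuspAt_eq_zero]; rintro _ ⟨⟩ _ ⟨⟩; exact h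
    omega
  have hnd := hl.nodup
  have hA : GoodPath Adj κ v a A u e := by
    refine ⟨hchain.1, ?_, hA0, ?_, he⟩
    · have : v :: (A ++ u :: B) = (v :: A ++ [u]) ++ B := by simp
      rw [this] at hnd
      exact (List.nodup_append.1 hnd).1
    · intro b hb
      refine (hs b ?_).1
      cases A <;> simpa using hb
  have hgmem : g ∈ B ++ [v] := List.mem_of_head? hg
  -- The two neighbours of `u` could only coincide at `v`, and then the cycle would have just two
  -- nodes.
  have hne : e ≠ g := by
    rintro rfl
    rcases List.mem_append.1 hgmem with h | h
    · grind
    · obtain rfl : e = v := by simpa using h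
      have hA' : A = [] := by
        rcases List.eq_nil_or_concat A with rfl | ⟨A', z, rfl⟩
        · rfl
        · simp [List.getLast?_cons] at he
          subst he
          simp at hnd
      have hB' : B = [] := by
        cases B with
        | nil => rfl
        | cons z B' =>
          simp at hg
          subst hg
          simp at hnd
      have := hl.two_le
      simp [hA', hB'] at this
  have huD : u ∈ D := hD u e g heg hne
  have hadj : Adj e u := by
    have := hchain.1
    rw [List.isChain_append] at this
    exact this.2.2 e he u (by simp)
  refine ⟨u, e, g, ⟨A, hA, ?_⟩, hadj, hne, heg⟩
  intro R₀ y₀ f₀ hR₀ hy₀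
  -- The return path is truncated at the first node it shares with the cycle. This `x` may lie after
  -- `u`, although the forbidden return is to a node before `u`.
  obtain ⟨R, x, f, hR, hx, hfirst⟩ := hR₀.exists_prefix (· ∈ v :: A ++ B)
    ⟨y₀, by simp, List.mem_append_left _ hy₀⟩
  clear hR₀ hy₀ R₀ y₀ f₀
  simp only at hR
  have hRnd := hR.nodup
  have hRc := hR.chain
  have hRcu := hR.cusps_eq
  have hRlast := hR.last
  obtain ⟨r, hr⟩ : ∃ r, (R ++ [x]).head? = some r := ⟨_, List.head?_eq_some_head (by simp)⟩
  have her : κ u e ≠ κ u r := hR.start r hr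
  have hrevc : (x :: R.reverse ++ [u]).IsChain Adj := by
    have : x :: R.reverse ++ [u] = (u :: R ++ [x]).reverse := by simp
    rw [this, List.isChain_reverse]
    exact hRc.imp hsymm
  have hrevcu : cusps κ (x :: (R.reverse ++ [u])) = 0 := by
    have : x :: (R.reverse ++ [u]) = (u :: R ++ [x]).reverse := by simp
    rw [this, cusps_reverse, hRcu]
  have hhead : ∀ Z, (R ++ x :: Z).head? = some r := by
    intro Z; cases R <;> simpa using hr
  have hlast : ∀ Z, (R.reverse ++ u :: Z).head? = some f := by
    intro Z; rw [← hRlast]; cases R <;> simp [List.getLast?_cons, List.head?_append]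
  rcases List.mem_append.1 hx with hxA | hxB
  -- Landing before `u`: the cycle made of the chord and `A₂` can have its cusp only at `x`, so `f`
  -- and `c` have the same colour there. Replacing `A₂` by the reversed chord then creates no cusp
  -- at `x` and removes the one at `u`, against minimality.
  · obtain ⟨A₁, A₂, hA₁₂⟩ := List.append_of_mem hxA
    have hAe : v :: A ++ [u] = A₁ ++ x :: (A₂ ++ [u]) := by rw [hA₁₂]; simp
    have hAc := hchain.1
    rw [hAe, List.isChain_split] at hAc
    have hAcu := hA0
    rw [hAe, cusps_append] at hAcu
    obtain ⟨c, hc⟩ : ∃ c, (A₂ ++ [u]).head? = some c := ⟨_, List.head?_eq_some_head (by simp)⟩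
    have hA₂e : (x :: A₂).getLast? = some e := by
      rw [← he, hA₁₂]; simp [List.getLast?_append, List.getLast?_cons]
    have hcyc₁ : IsCyc Adj u (R ++ x :: A₂) := by
      refine ⟨?_, ?_, ?_⟩
      · have : u :: (R ++ x :: A₂) ++ [u] = u :: R ++ x :: (A₂ ++ [u]) := by simp
        rw [this]
        exact List.isChain_split.2 ⟨hRc, hAc.2⟩
      · have : (A₁ ++ x :: A₂ ++ u :: B).Nodup := by rw [← hA₁₂]; simpa using hnd
        rw [hA₁₂] at hfirst
        exact (nodup_shortcut_left hRnd this hfirst).1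
      · by_contra hlt
        have h₁ : R = [] := List.length_eq_zero_iff.1 (by simp at hlt; omega)
        have h₂ : A₂ = [] := List.length_eq_zero_iff.1 (by simp at hlt; omega)
        subst h₁ h₂
        simp at hA₂e hr
        subst hA₂e hr
        exact her rfl
    have hcy₁ := H u huD _ hcyc₁ (by
      rw [hhead]
      rintro _ ⟨⟩ z hz
      have : (R ++ x :: A₂).getLast? = some e := by
        rw [← hA₂e]; simp [List.getLast?_append, List.getLast?_cons]
      rw [this] at hz
      cases hz
      exact her.symm)
    have hfc : κ x f = κ x c := by
      by_contra h
      apply hcy₁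
      have : u :: (R ++ x :: A₂) ++ [u] = u :: R ++ x :: (A₂ ++ [u]) := by simp
      rw [this, cusps_append, hRcu, hRlast, hc, cuspAt_eq_zero.2]
      · omega
      · rintro _ ⟨⟩ _ ⟨⟩; exact h
    obtain ⟨l₂, hl₂⟩ : ∃ l₂, v :: l₂ = A₁ ++ x :: (R.reverse ++ u :: B) := by
      cases A₁ <;> simp at hA₁₂ ⊢ <;> simp [hA₁₂]
    have hl₂' : v :: l₂ ++ [v] = A₁ ++ x :: (R.reverse ++ u :: (B ++ [v])) := by
      rw [hl₂]; simp
    have hl₂last : l₂.getLast? = (A ++ u :: B).getLast? := by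
      have h₁ : (v :: l₂).getLast? = (u :: B).getLast? := by
        rw [hl₂]; simp [List.getLast?_append, List.getLast?_cons]
      have h₂ : (A ++ u :: B).getLast? = (u :: B).getLast? := by
        simp [List.getLast?_append, List.getLast?_cons]
      rw [h₂, ← h₁]
      cases l₂ with
      | nil => cases A₁ <;> simp at hl₂
      | cons => simp
    have hS₂ : l₂ ∈ S := by
      refine ⟨⟨?_, ?_, ?_⟩, ?_⟩
      · rw [hl₂']
        refine List.isChain_split.2 ⟨hAc.1, ?_⟩
        rw [← List.cons_append]
        exact List.isChain_split.2 ⟨hrevc, hchain.2⟩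
      · have : (A₁ ++ x :: A₂ ++ u :: B).Nodup := by rw [← hA₁₂]; simpa using hnd
        rw [hA₁₂] at hfirst
        rw [hl₂]
        exact (nodup_shortcut_left hRnd this hfirst).2
      · by_contra hlt
        have hlen := congrArg List.length hl₂
        simp at hlen
        have h₁ : R = [] := List.length_eq_zero_iff.1 (by omega)
        have h₂ : A₁ = [] := List.length_eq_zero_iff.1 (by omega)
        have h₃ : B = [] := List.length_eq_zero_iff.1 (by omega)
        subst h₁ h₂ h₃
        simp at hg hr hA₁₂
        apply her
        rw [heg, ← hg, ← hr, hA₁₂.1]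
      · rw [hl₂last]
        -- If `x = v`, the new cycle leaves `v` by `f` instead of `c`; the colours agree, so it
        -- stays in `S`.
        cases A₁ with
        | nil =>
          simp only [List.nil_append, List.cons.injEq] at hl₂ hA₁₂
          obtain ⟨rfl, rfl⟩ := hA₁₂
          rw [hl₂.2, hlast]
          rintro _ ⟨⟩
          rw [hfc]
          refine hs c ?_
          cases A <;> simpa using hc
        | cons q A₁ =>
          simp only [List.cons_append, List.cons.injEq] at hl₂ hA₁₂
          rw [hl₂.2]
          have := hs
          rw [hA₁₂.2] at this ⊢
          cases A₁ <;> simpa using this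
    have h₂ := hmin l₂ hS₂
    rw [hcω, hl₂', cusps_append] at h₂
    rw [← List.cons_append (a := x), cusps_append _ _ (x :: R.reverse), List.cons_append, hrevcu, hlast, hg] at h₂
    have h₃ : cuspAt κ A₁.getLast? x (some f) = 0 := by
      rw [cuspAt_eq_zero]
      rintro q hq _ ⟨⟩
      rw [hfc]
      have : cuspAt κ A₁.getLast? x (A₂ ++ [u]).head? = 0 := by omega
      exact cuspAt_eq_zero.1 this q hq c hc
    have h₄ : cuspAt κ (x :: R.reverse).getLast? u (some g) = 0 := by
      have : (x :: R.reverse).getLast? = some r := by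
        rw [← hr, ← List.head?_reverse]; simp
      rw [this, cuspAt_eq_zero]
      rintro _ ⟨⟩ _ ⟨⟩
      rw [← heg]
      exact her.symm
    omega
  -- Landing after `u`: replacing `B₁` by the chord removes the cusp at `u`, so minimality forces a
  -- cusp at `x` between `f` and `c`, and leaves none along `B₁` nor at `x` between `q` and `c`. The
  -- cycle made of the chord and the reversed `B₁` then has no cusp, against `H`.
  · obtain ⟨B₁, B₂, rfl⟩ := List.append_of_mem hxB
    have hBe : u :: (B₁ ++ x :: B₂ ++ [v]) = u :: B₁ ++ x :: (B₂ ++ [v]) := by simp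
    have hBc := hchain.2
    rw [hBe, List.isChain_split] at hBc
    obtain ⟨c, hc⟩ : ∃ c, (B₂ ++ [v]).head? = some c := ⟨_, List.head?_eq_some_head (by simp)⟩
    obtain ⟨q, hq⟩ : ∃ q, (u :: B₁).getLast? = some q :=
      ⟨_, List.getLast?_eq_some_getLast (by simp)⟩
    have hl₃ : v :: (A ++ u :: (R ++ x :: B₂)) ++ [v] =
      v :: A ++ u :: (R ++ x :: (B₂ ++ [v])) := by simp
    have hS₃ : A ++ u :: (R ++ x :: B₂) ∈ S := by
      refine ⟨⟨?_, ?_, ?_⟩, ?_⟩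
      · rw [hl₃]
        refine List.isChain_split.2 ⟨hchain.1, ?_⟩
        rw [← List.cons_append]
        exact List.isChain_split.2 ⟨hRc, hBc.2⟩
      · exact (nodup_shortcut_right (A := v :: A) hRnd hnd hfirst).1
      · simp; omega
      · have h₁ : (A ++ u :: (R ++ x :: B₂)).getLast? = (A ++ u :: (B₁ ++ x :: B₂)).getLast? := by
          simp [List.getLast?_append, List.getLast?_cons]
        rw [h₁]
        have := hs
        cases A <;> simpa using this
    have h₃ := hmin _ hS₃
    rw [hcω, hl₃, cusps_append, hA0, hhead, he, hBe, cusps_append,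
      ← List.cons_append (a := u) (as := R), cusps_append _ _ (u :: R), hRcu, hRlast, hc, hq] at h₃
    have h₄ : cuspAt κ (some e) u (some r) = 0 := by
      rw [cuspAt_eq_zero]; rintro _ ⟨⟩ _ ⟨⟩; exact her
    have h₅ := cuspAt_le_one (κ := κ) (some f) x (some c)
    have h₆ : cuspAt κ (some q) x (some c) = 0 := by omega
    have h₇ : cusps κ (u :: B₁ ++ [x]) = 0 := by omega
    have h₈ : cuspAt κ (some f) x (some c) ≠ 0 := by omega
    have hfc : κ x f = κ x c := by
      by_contra h
      apply h₈
      rw [cuspAt_eq_zero]; rintro _ ⟨⟩ _ ⟨⟩; exact h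
    have hB₁g : (x :: B₁.reverse).getLast? = some g := by
      rw [← hg, ← List.head?_reverse]
      cases B₁ <;> simp
    have hrev : x :: (B₁.reverse ++ [u]) = (u :: B₁ ++ [x]).reverse := by simp
    have hl₄ : u :: (R ++ x :: B₁.reverse) ++ [u] = u :: R ++ x :: (B₁.reverse ++ [u]) := by simp
    have hcyc₄ : IsCyc Adj u (R ++ x :: B₁.reverse) := by
      refine ⟨?_, ?_, ?_⟩
      · rw [hl₄]
        refine List.isChain_split.2 ⟨hRc, ?_⟩
        rw [hrev, List.isChain_reverse]
        exact hBc.1.imp hsymm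
      · exact (nodup_shortcut_right (A := v :: A) hRnd hnd hfirst).2
      · by_contra hlt
        have h₁ : R = [] := List.length_eq_zero_iff.1 (by simp at hlt; omega)
        have h₂ : B₁ = [] := List.length_eq_zero_iff.1 (by simp at hlt; omega)
        subst h₁ h₂
        simp at hg hr
        apply her
        rw [heg, ← hg, ← hr]
    refine H u huD _ hcyc₄ ?_ ?_
    · rw [hhead]
      rintro _ ⟨⟩ z hz
      have : (R ++ x :: B₁.reverse).getLast? = some g := by
        rw [← hB₁g]; simp [List.getLast?_append, List.getLast?_cons]
      rw [this] at hz
      cases hz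
      rw [← heg]
      exact her.symm
    · have : (B₁.reverse ++ [u]).head? = some q := by
        rw [← hq, ← List.head?_reverse]; simp
      rw [hl₄, cusps_append, hRcu, hRlast, this, hrev, cusps_reverse, h₇, cuspAt_eq_zero.2]
      rintro _ ⟨⟩ _ ⟨⟩
      rw [hfc]
      intro h
      exact cuspAt_eq_zero.1 h₆ q rfl c rfl h.symm

/-! ### Reversal, rotation and neighbours in a cycle. -/

theorem IsCyc.reverse (hsymm : ∀ x y, Adj x y → Adj y x) {x : N} {l : List N}
    (h : IsCyc Adj x l) : IsCyc Adj x l.reverse := by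
  refine ⟨?_, ?_, by simpa using h.two_le⟩
  · have : x :: l.reverse ++ [x] = (x :: l ++ [x]).reverse := by simp
    rw [this, List.isChain_reverse]
    exact h.chain.imp hsymm
  · simpa using h.nodup

theorem IsCyc.rotate {x y : N} {l₁ l₂ : List N} (h : IsCyc Adj x (l₁ ++ y :: l₂)) :
    IsCyc Adj y (l₂ ++ x :: l₁) := by
  have hc := h.chain
  have e₁ : x :: (l₁ ++ y :: l₂) ++ [x] = x :: l₁ ++ y :: (l₂ ++ [x]) := by simp
  have e₂ : y :: (l₂ ++ x :: l₁) ++ [y] = y :: l₂ ++ x :: (l₁ ++ [y]) := by simp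
  rw [e₁, List.isChain_split] at hc
  refine ⟨?_, ?_, ?_⟩
  · rw [e₂]
    exact List.isChain_split.2 ⟨hc.2, hc.1⟩
  · refine (List.Perm.nodup_iff ?_).1 h.nodup
    have : (x :: l₁ ++ y :: l₂).Perm (y :: l₂ ++ x :: l₁) := List.perm_append_comm
    simpa using this
  · have := h.two_le
    simp at this ⊢
    omega

theorem IsCyc.exists_rotate {x y : N} {l : List N} (h : IsCyc Adj x l) (hy : y ∈ x :: l) :
    ∃ l', IsCyc Adj y l' := by
  rcases List.mem_cons.1 hy with rfl | hy
  · exact ⟨l, h⟩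
  · obtain ⟨l₁, l₂, rfl⟩ := List.append_of_mem hy
    exact ⟨_, h.rotate⟩

theorem IsCyc.head_ne_last {x : N} {l : List N} (h : IsCyc Adj x l) {b z : N} (hb : b ∈ l.head?)
    (hz : z ∈ l.getLast?) : b ≠ z := by
  have h₁ := h.two_le
  have h₂ := (List.nodup_cons.1 h.nodup).2
  match l, h₁ with
  | a :: c :: l, _ =>
    simp only [List.head?_cons, Option.mem_some_iff] at hb
    subst hb
    rw [List.getLast?_cons_cons] at hz
    rintro rfl
    exact (List.nodup_cons.1 h₂).1 (List.mem_of_getLast? hz)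

theorem cusps_eq_zero_getElem? : ∀ {L : List N}, cusps κ L = 0 → ∀ (i : ℕ) (a b c : N),
    L[i]? = some a → L[i + 1]? = some b → L[i + 2]? = some c → κ b a ≠ κ b c
  | [], _, i, a, b, c, ha, _, _ => by simp at ha
  | [_], _, i, a, b, c, _, hb, _ => by simp at hb
  | x :: y :: L, h, 0, a, b, c, ha, hb, hc => by
    simp only [cusps, Nat.add_eq_zero_iff] at h
    refine cuspAt_eq_zero.1 ?_ a rfl c rfl
    simp only [List.getElem?_cons_zero, Option.some.injEq] at ha
    simp only [List.getElem?_cons_succ, List.getElem?_cons_zero, Option.some.injEq, zero_add] at hb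
    subst ha hb
    have : L.head? = some c := by
      rw [← hc]; cases L <;> simp
    rw [← this]
    exact h.1
  | x :: y :: L, h, i + 1, a, b, c, ha, hb, hc => by
    simp only [cusps, Nat.add_eq_zero_iff] at h
    exact cusps_eq_zero_getElem? h.2 i a b c (by simpa using ha) (by simpa using hb)
      (by simpa using hc)

/-- In a cycle without cusp, two nodes which are consecutive to the same node have different
colours. -/
theorem IsCyc.false_of_consecutive {x : N} {l : List N} (h : IsCyc Adj x l)
    (hcusp : cusps κ (x :: l ++ [x]) = 0)
    (hx : ∀ b ∈ l.head?, ∀ z ∈ l.getLast?, κ x b ≠ κ x z) {w e f : N} (hef : e ≠ f)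
    (hκ : κ w e = κ w f)
    (he : ∃ i : ℕ, ((x :: l ++ [x])[i]? = some w ∧ (x :: l ++ [x])[i + 1]? = some e) ∨
      ((x :: l ++ [x])[i]? = some e ∧ (x :: l ++ [x])[i + 1]? = some w))
    (hf : ∃ i : ℕ, ((x :: l ++ [x])[i]? = some w ∧ (x :: l ++ [x])[i + 1]? = some f) ∨
      ((x :: l ++ [x])[i]? = some f ∧ (x :: l ++ [x])[i + 1]? = some w)) : False := by
  have key₀ : ∀ (i : ℕ) (a : N), (x :: l ++ [x])[i + 1]? = some a → i < l.length + 1 := by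
    intro i a hi
    have := (List.getElem?_eq_some_iff.1 hi).1
    simp at this
    omega
  -- Only `x` occurs twice, at both ends of the list: `key₁` leaves out the last position, `key₂`
  -- the first.
  have key₁ : ∀ i j : ℕ, i < l.length + 1 → j < l.length + 1 → (x :: l ++ [x])[i]? = some w →
      (x :: l ++ [x])[j]? = some w → i = j := by
    intro i j hi hj h₁ h₂
    rw [List.getElem?_append_left (by simpa using hi)] at h₁
    rw [List.getElem?_append_left (by simpa using hj)] at h₂
    exact (List.getElem?_inj (by simpa using hi) h.nodup).1 (h₁.trans h₂.symm)
  have hnd : (l ++ [x]).Nodup := by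
    have := h.nodup
    refine (List.Perm.nodup_iff ?_).1 this
    have : ([x] ++ l).Perm (l ++ [x]) := List.perm_append_comm
    simpa using this
  have key₂ : ∀ i j : ℕ, (x :: l ++ [x])[i + 1]? = some w → (x :: l ++ [x])[j + 1]? = some w →
      i = j := by
    intro i j h₁ h₂
    have hi := key₀ _ _ h₁
    rw [List.cons_append, List.getElem?_cons_succ] at h₁ h₂
    exact (List.getElem?_inj (by simpa using hi) hnd).1 (h₁.trans h₂.symm)
  -- Here `f` precedes `w` and `e` follows it. Either both occurrences of `w` are the same and this
  -- is an inner cusp, or `w` is the base point and `hx` applies.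
  have key₃ : ∀ (i j : ℕ) (e f : N), κ w e = κ w f → (x :: l ++ [x])[i]? = some w →
      (x :: l ++ [x])[i + 1]? = some e → (x :: l ++ [x])[j]? = some f →
      (x :: l ++ [x])[j + 1]? = some w → False := by
    intro i j e f hκ h₁ h₂ h₃ h₄
    have hi := key₀ _ _ h₂
    have hj := key₀ _ _ h₄
    rcases eq_or_ne i (j + 1) with rfl | hij
    · exact cusps_eq_zero_getElem? hcusp j f w e h₃ h₄ h₂ hκ.symm
    · have hjl : j = l.length := by
        by_contra hne
        exact hij (key₁ _ _ hi (by omega) h₁ h₄)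
      subst hjl
      have hwx : w = x := by
        rw [List.cons_append, List.getElem?_cons_succ, List.getElem?_append_right le_rfl] at h₄
        simpa using h₄.symm
      have hi0 : i = 0 := key₁ _ _ hi (by omega) h₁ (by simp [hwx])
      subst hi0 hwx
      have hl := h.two_le
      refine hx e ?_ f ?_ hκ
      · rw [Option.mem_def, ← h₂]; cases l <;> simp at hl ⊢
      · rw [Option.mem_def, ← h₃, List.getElem?_append_left (by simp), List.getLast?_eq_getElem?]
        obtain ⟨k, hk⟩ : ∃ k, l.length = k + 1 := ⟨l.length - 1, by omega⟩
        simp [hk]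
  obtain ⟨i, ⟨h₁, h₂⟩ | ⟨h₁, h₂⟩⟩ := he <;> obtain ⟨j, ⟨h₃, h₄⟩ | ⟨h₃, h₄⟩⟩ := hf
  · have := key₁ i j (key₀ _ _ h₂) (key₀ _ _ h₄) h₁ h₃
    subst this
    exact hef (Option.some.inj (h₂.symm.trans h₄))
  · exact key₃ i j e f hκ h₁ h₂ h₃ h₄
  · exact key₃ j i f e hκ.symm h₃ h₄ h₁ h₂
  · have := key₂ i j h₂ h₄
    subst this
    exact hef (Option.some.inj (h₁.symm.trans h₃))

/-- The bound `two_le` is what keeps the two neighbours apart: with `l = [e]` both would be `x`. -/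
theorem IsCyc.exists_neighbours {x : N} {l : List N} (h : IsCyc Adj x l) {e : N} (he : e ∈ l) :
    ∃ (i : ℕ) (a b : N), (x :: l ++ [x])[i]? = some a ∧ (x :: l ++ [x])[i + 1]? = some e ∧
      (x :: l ++ [x])[i + 2]? = some b ∧ a ≠ b ∧ Adj a e ∧ Adj e b := by
  obtain ⟨l₁, l₂, rfl⟩ := List.append_of_mem he
  obtain ⟨X, a, hX⟩ : ∃ X a, x :: l₁ = X ++ [a] := by
    rcases List.eq_nil_or_concat (x :: l₁) with h | ⟨X, a, h⟩
    · simp at h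
    · exact ⟨X, a, by simpa using h⟩
  obtain ⟨b, Y, hY⟩ : ∃ b Y, l₂ ++ [x] = b :: Y := by
    cases l₂ <;> simp
  have hL : x :: (l₁ ++ e :: l₂) ++ [x] = X ++ a :: e :: b :: Y := by
    have : x :: (l₁ ++ e :: l₂) ++ [x] = x :: l₁ ++ e :: (l₂ ++ [x]) := by simp
    rw [this, hX, hY]
    simp
  have hc := h.chain
  rw [hL, List.isChain_append] at hc
  have hc' := hc.2.1
  simp only [List.isChain_cons_cons] at hc'
  refine ⟨X.length, a, b, ?_, ?_, ?_, ?_, hc'.1, hc'.2.1⟩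
  · rw [hL]; simp
  · rw [hL, List.getElem?_append_right (by omega)]; simp
  · rw [hL, List.getElem?_append_right (by omega)]; simp
  · rintro rfl
    have hnd := h.nodup
    have h2 := h.two_le
    have ha : a ∈ x :: l₁ := by rw [hX]; simp
    cases l₂ with
    | nil =>
      obtain ⟨rfl, -⟩ : x = a ∧ [] = Y := by simpa using hY
      cases X with
      | nil =>
        obtain rfl : l₁ = [] := by simpa using hX
        simp at h2
      | cons c X =>
        obtain ⟨rfl, rfl⟩ : x = c ∧ l₁ = X ++ [x] := by simpa using hX
        simp at hnd
    | cons c l₂ =>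
      obtain ⟨rfl, -⟩ : c = a ∧ l₂ ++ [x] = Y := by simpa using hY
      rw [← List.cons_append, List.nodup_append] at hnd
      exact hnd.2.2 c ha c (by simp) rfl

end Trail

/-! ### Paths of a partial graph as lists of nodes of its incidence graph. -/

namespace PartialGraph

open Trail

variable {G : PartialGraph}

/-- Symmetric incidence. -/
def Inc (G : PartialGraph) (x y : G.V ⊕ G.E) : Prop := G.Incident x y ∨ G.Incident y x

theorem Inc.symm (x y : G.V ⊕ G.E) (h : G.Inc x y) : G.Inc y x := Or.symm h

@[simp] theorem inc_inl_inr {v : G.V} {e : G.E} :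
    G.Inc (.inl v) (.inr e) ↔ G.src e = some v ∨ G.tgt e = some v := by
  simp [Inc, Incident]

@[simp] theorem inc_inr_inl {v : G.V} {e : G.E} :
    G.Inc (.inr e) (.inl v) ↔ G.src e = some v ∨ G.tgt e = some v := by
  simp [Inc, Incident]

@[simp] theorem not_inc_inl_inl {v w : G.V} : ¬ G.Inc (.inl v) (.inl w) := by
  simp [Inc, Incident]

@[simp] theorem not_inc_inr_inr {e f : G.E} : ¬ G.Inc (.inr e) (.inr f) := by
  simp [Inc, Incident]

/-- An edge has at most two endpoints, so two distinct neighbours exhaust them. -/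
theorem eq_or_eq_of_inc {e : G.E} {x y : G.V ⊕ G.E} {w : G.V} (hx : G.Inc x (.inr e))
    (hy : G.Inc (.inr e) y) (hxy : x ≠ y) (hw : G.Inc (.inl w) (.inr e)) :
    .inl w = x ∨ .inl w = y := by
  rcases x with x | x <;> rcases y with y | y <;> simp at hx hy hw
  grind

namespace Path

/-- The list `[v₀, e₁, v₁, …, eₙ, vₙ]`. -/
def nodes : {u v : G.V} → Path G u v → List (G.V ⊕ G.E)
  | _, _, nil v => [.inl v]
  | u, _, cons e _ p => .inl u :: .inr e :: p.nodes

theorem exists_nodes_eq_cons {u v : G.V} : ∀ p : Path G u v, ∃ l, p.nodes = .inl u :: l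
  | nil _ => ⟨_, rfl⟩
  | cons _ _ _ => ⟨_, rfl⟩

theorem exists_nodes_eq_concat {u v : G.V} : ∀ p : Path G u v, ∃ l, p.nodes = l ++ [.inl v]
  | nil _ => ⟨[], rfl⟩
  | cons e _ p => by
    obtain ⟨l, hl⟩ := exists_nodes_eq_concat p
    exact ⟨.inl u :: .inr e :: l, by simp [nodes, hl]⟩

theorem isChain_nodes {u v : G.V} : ∀ p : Path G u v, p.nodes.IsChain G.Inc
  | nil _ => by simp [nodes]
  | cons e h p => by
    obtain ⟨l, hl⟩ := exists_nodes_eq_cons p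
    have := isChain_nodes p
    simp only [nodes, hl, List.isChain_cons_cons, inc_inl_inr, inc_inr_inl] at this ⊢
    have := h.2
    grind

theorem inl_mem_nodes {u v w : G.V} : ∀ p : Path G u v, .inl w ∈ p.nodes ↔ w ∈ p.vertices
  | nil _ => by simp [nodes, vertices]
  | cons e h p => by simp [nodes, vertices, inl_mem_nodes p]

theorem inr_mem_nodes {u v : G.V} {f : G.E} : ∀ p : Path G u v, .inr f ∈ p.nodes ↔ f ∈ p.edges
  | nil _ => by simp [nodes, edges]
  | cons e h p => by simp [nodes, edges, inr_mem_nodes p]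

theorem nodup_nodes {u v : G.V} : ∀ p : Path G u v,
    p.nodes.Nodup ↔ p.vertices.Nodup ∧ p.edges.Nodup
  | nil _ => by simp [nodes, vertices, edges]
  | cons e h p => by
    simp [nodes, vertices, edges, inr_mem_nodes p, inl_mem_nodes p, nodup_nodes p]
    tauto

/-- Since edges are nodes too, parallel edges stay distinct, and a cycle of two vertices and two
edges becomes a simple cycle with four nodes. -/
theorem isCycle_iff {u : G.V} (p : Path G u u) :
    p.IsCycle ↔ ∃ l, p.nodes = .inl u :: l ++ [.inl u] ∧ IsCyc G.Inc (.inl u) l := by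
  match p with
  | nil _ => simp [IsCycle, edges, nodes]
  | cons e h p =>
    obtain ⟨X, hX⟩ := exists_nodes_eq_concat p
    have hX0 : X ≠ [] := by
      rintro rfl
      obtain ⟨l, hl⟩ := exists_nodes_eq_cons p
      rw [hX] at hl
      simp at hl
      exact h.1 hl.1
    have h₁ : (cons e h p).IsCycle ↔ (Sum.inr e :: p.nodes).Nodup := by
      rw [List.nodup_cons, inr_mem_nodes, nodup_nodes]
      simp [IsCycle, edges, vertices]
      tauto
    have h₂ : (Sum.inr e :: p.nodes).Nodup ↔ (Sum.inl u :: Sum.inr e :: X).Nodup := by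
      rw [hX]
      refine List.Perm.nodup_iff ?_
      exact (List.perm_append_comm : (Sum.inr e :: X ++ [Sum.inl u]).Perm _)
    rw [h₁, h₂]
    have h₃ : (cons e h p).nodes = .inl u :: (.inr e :: X) ++ [.inl u] := by simp [nodes, hX]
    constructor
    · intro hnd
      refine ⟨_, h₃, ?_, hnd, ?_⟩
      · rw [← h₃]; exact isChain_nodes _
      · cases X with
        | nil => simp at hX0
        | cons => simp
    · rintro ⟨l, hl, hc⟩
      rw [h₃] at hl
      have : Sum.inr e :: X = l := by simpa using (List.append_inj' hl rfl).1
      rw [this]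
      exact hc.nodup

/-- The number `n` is fuel for a recursion that removes an edge and a vertex at a time. The last
hypothesis excludes the list that follows one edge and comes straight back. -/
theorem exists_of_isChain (w : G.V) : ∀ (n : ℕ) (l : List (G.V ⊕ G.E)) (v : G.V), l.length ≤ n →
    (.inl v :: l ++ [.inl w] : List (G.V ⊕ G.E)).IsChain G.Inc →
    (.inl v :: l : List (G.V ⊕ G.E)).Nodup → (l ++ [.inl w] : List (G.V ⊕ G.E)).Nodup →
    (l.length ≤ 1 → v ≠ w) → ∃ p : Path G v w, p.nodes = .inl v :: l ++ [.inl w]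
  | _, [], v, _, hc, _, _, _ => by simp at hc
  | _, .inl x :: l, v, _, hc, _, _, _ => by simp at hc
  | _, [.inr e], v, _, hc, _, _, hvw => by
    have hvw := hvw (by simp)
    simp at hc
    exact ⟨cons e ⟨hvw, by grind⟩ (nil w), rfl⟩
  | _, .inr e :: .inr f :: l, v, _, hc, _, _, _ => by simp at hc
  | n + 1, .inr e :: .inl x :: l, v, hn, hc, hnd, hnd', _ => by
    obtain ⟨p, hp⟩ := exists_of_isChain w n l x (by simp at hn; omega) (by simp at hc; simpa using hc.2.2)
      (by simp at hnd; simpa using hnd.2.2) (by simp at hnd'; simpa using hnd'.2.2)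
      (by simp at hnd'; tauto)
    have hvx : v ≠ x := by simp at hnd; tauto
    simp only [List.cons_append, List.isChain_cons_cons, inc_inl_inr, inc_inr_inl] at hc
    exact ⟨cons e ⟨hvx, by grind⟩ p, by simp [nodes, hp]⟩

theorem exists_isCycle {v : G.V} {l : List (G.V ⊕ G.E)} (h : IsCyc G.Inc (.inl v) l) :
    ∃ p : Path G v v, p.IsCycle ∧ p.nodes = .inl v :: l ++ [.inl v] := by
  obtain ⟨p, hp⟩ := exists_of_isChain v l.length l v le_rfl h.chain h.nodup (by
    refine (List.Perm.nodup_iff ?_).1 h.nodup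
    exact (List.perm_append_comm : ([Sum.inl v] ++ l).Perm _)) (by
    intro h'
    have := h.two_le
    omega)
  exact ⟨p, (isCycle_iff p).2 ⟨l, hp, h⟩, hp⟩

theorem IsCycle.exists_isCyc {u : G.V} {p : Path G u u} (h : p.IsCycle) {x : G.V ⊕ G.E}
    (hx : x ∈ p.nodes) : ∃ l, IsCyc G.Inc x l := by
  obtain ⟨l, hl, hc⟩ := (isCycle_iff p).1 h
  refine hc.exists_rotate ?_
  rw [hl] at hx
  simp at hx ⊢
  tauto

end Path

end PartialGraph

open Trail

/-! ### The colouring of a proof net and its splitting vertices. -/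

namespace LabeledGraph

variable {Atom : Type*} {ρ : LabeledGraph Atom}

open Classical in
/-- The local colouring: both premises of a `⅋`-vertex have the same colour, and all other edges at a
vertex have different colours. -/
noncomputable def colour (ρ : LabeledGraph Atom) (x a : ρ.V ⊕ ρ.E) : ρ.V ⊕ ρ.E :=
  if ∃ v e, x = .inl v ∧ a = .inr e ∧ ρ.rule v = .parr ∧ ρ.tgt e = some v then x else a

theorem colour_inl_inr (v : ρ.V) (e : ρ.E) [Decidable (ρ.rule v = .parr ∧ ρ.tgt e = some v)] :
    ρ.colour (.inl v) (.inr e) =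
      if ρ.rule v = .parr ∧ ρ.tgt e = some v then .inl v else .inr e := by
  unfold colour
  congr 1
  simp

@[simp] theorem colour_inr (e : ρ.E) (a : ρ.V ⊕ ρ.E) : ρ.colour (.inr e) a = a := by
  simp [colour]

@[simp] theorem colour_inl_inl (v w : ρ.V) : ρ.colour (.inl v) (.inl w) = .inl w := by
  simp [colour]

/-- The common colour of the premises of a ⅋-vertex is that vertex itself, which is never its own
neighbour; `ha` and `hc` rule out a clash with an ordinary colour. -/
theorem colour_eq_colour {x a c : ρ.V ⊕ ρ.E} (h : ρ.colour x a = ρ.colour x c) (hac : a ≠ c)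
    (ha : a ≠ x) (hc : c ≠ x) : ∃ v e f, x = .inl v ∧ a = .inr e ∧ c = .inr f ∧
      ρ.rule v = .parr ∧ ρ.tgt e = some v ∧ ρ.tgt f = some v := by
  unfold colour at h
  split_ifs at h with h₁ h₂ h₂
  · obtain ⟨v, e, rfl, rfl, hv, he⟩ := h₁
    obtain ⟨_, f, ⟨⟩, rfl, -, hf⟩ := h₂
    exact ⟨v, e, f, rfl, rfl, rfl, hv, he, hf⟩
  · exact absurd h.symm hc
  · exact absurd h ha
  · exact absurd h hac

theorem exists_vertex_of_colour_eq {x a c : ρ.V ⊕ ρ.E} (h : ρ.colour x a = ρ.colour x c)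
    (hac : a ≠ c) : ∃ v, x = .inl v := by
  rcases x with v | e
  · exact ⟨v, rfl⟩
  · simp at h
    exact absurd h hac

theorem colour_eq_of_not_parr {v : ρ.V} (hv : ρ.rule v ≠ .parr) (a : ρ.V ⊕ ρ.E) :
    ρ.colour (.inl v) a = a := by
  unfold colour
  rw [if_neg]
  rintro ⟨_, e, ⟨⟩, -, h, -⟩
  exact hv h

/-- In a correct structure every cycle has a cusp. -/
theorem DRCorrect.cusps_ne_zero (hρ : ρ.DRCorrect) {v : ρ.V} {l : List (ρ.V ⊕ ρ.E)}
    (h : IsCyc ρ.Inc (.inl v) l)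
    (hx : ∀ b ∈ l.head?, ∀ z ∈ l.getLast?, ρ.colour (.inl v) b ≠ ρ.colour (.inl v) z) :
    cusps ρ.colour (.inl v :: l ++ [.inl v]) ≠ 0 := by
  intro h0
  obtain ⟨p, hp, hpl⟩ := PartialGraph.Path.exists_isCycle h
  refine hρ v p hp ?_
  rintro w hw e f he hf hef ⟨hep, hfp⟩
  -- On a cycle an edge lies between its two endpoints, so a premise of `w` is next to `w`.
  have hcons : ∀ g, g ∈ p.edges → ρ.tgt g = some w → ∃ i : ℕ,
      ((.inl v :: l ++ [.inl v] : List (ρ.V ⊕ ρ.E))[i]? = some (.inl w) ∧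
        (.inl v :: l ++ [.inl v] : List (ρ.V ⊕ ρ.E))[i + 1]? = some (.inr g)) ∨
      ((.inl v :: l ++ [.inl v] : List (ρ.V ⊕ ρ.E))[i]? = some (.inr g) ∧
        (.inl v :: l ++ [.inl v] : List (ρ.V ⊕ ρ.E))[i + 1]? = some (.inl w)) := by
    intro g hg hgw
    rw [← PartialGraph.Path.inr_mem_nodes, hpl] at hg
    have hgl : Sum.inr g ∈ l := by simpa using hg
    obtain ⟨i, a, b, ha, hg', hb, hab, h₁, h₂⟩ := h.exists_neighbours hgl
    rcases PartialGraph.eq_or_eq_of_inc h₁ h₂ hab (w := w) (by simp [hgw]) with rfl | rfl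
    · exact ⟨i, Or.inl ⟨ha, hg'⟩⟩
    · exact ⟨i + 1, Or.inr ⟨hg', hb⟩⟩
  classical
  refine h.false_of_consecutive h0 hx (w := .inl w) (e := .inr e) (f := .inr f)
    (by simpa using hef) ?_ (hcons e hep he) (hcons f hfp hf)
  rw [colour_inl_inr, colour_inl_inr, if_pos ⟨hw, he⟩, if_pos ⟨hw, hf⟩]

theorem src_ne_tgt {G : PartialGraph} (h : G.DirectedAcyclic) {e : G.E} {v : G.V}
    (hs : G.src e = some v) (ht : G.tgt e = some v) : False :=
  h v (.single ⟨e, hs, ht⟩)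

/-- The vertex `v` is in no cycle whose two edges at `v` have different colours. -/
def NoCuspFreeCycleAt (ρ : LabeledGraph Atom) (v : ρ.V) : Prop :=
  ∀ l, IsCyc ρ.Inc (.inl v) l → ∀ b ∈ l.head?, ∀ z ∈ l.getLast?,
    ρ.colour (.inl v) b = ρ.colour (.inl v) z

/-- A cycle through `c` passes from `c` to its source `v`. By acyclicity `c` is not a premise of
`v`, so its colour at `v` is shared with no other edge and there is no cusp at `v`. -/
theorem NoCuspFreeCycleAt.conclusion (hac : ρ.DirectedAcyclic) {v : ρ.V}
    (hv : ρ.NoCuspFreeCycleAt v) {c : ρ.E} (hc : ρ.src c = some v) (l : List (ρ.V ⊕ ρ.E)) :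
    ¬ IsCyc ρ.Inc (.inr c) l := by
  have key : ∀ l, ¬ IsCyc ρ.Inc (.inr c) (l ++ [.inl v]) := by
    intro l hl
    have h : IsCyc ρ.Inc (.inl v) (.inr c :: l) := by simpa using hl.rotate
    obtain ⟨z, hz⟩ : ∃ z, (Sum.inr c :: l).getLast? = some z :=
      ⟨_, List.getLast?_eq_some_getLast (by simp)⟩
    have hcz := h.head_ne_last (b := .inr c) rfl hz
    have hzv : z ≠ .inl v := by
      rintro rfl
      exact (List.nodup_cons.1 h.nodup).1 (List.mem_of_getLast? hz)
    obtain ⟨_, e, f, ⟨⟩, ⟨⟩, -, -, ht, -⟩ :=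
      colour_eq_colour (hv _ h (.inr c) rfl z hz) hcz (by simp) hzv
    exact src_ne_tgt hac hc ht
  intro hl
  have h2 := hl.two_le
  obtain ⟨b, l', rfl⟩ : ∃ b l', l = b :: l' := by
    cases l with
    | nil => simp at h2
    | cons b l' => exact ⟨b, l', rfl⟩
  obtain ⟨l', z, hz⟩ : ∃ l'' z, b :: l' = l'' ++ [z] := by
    rcases List.eq_nil_or_concat (b :: l') with h | ⟨X, a, h⟩
    · simp at h
    · exact ⟨X, a, by simpa using h⟩
  have hne : b ≠ z := hl.head_ne_last rfl (by rw [hz]; simp)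
  have hcb : ρ.Inc (.inr c) b := by
    have := hl.chain
    simp only [List.cons_append, List.isChain_cons_cons] at this
    exact this.1
  have hzc : ρ.Inc z (.inr c) := by
    have := hl.chain
    rw [hz, ← List.cons_append, List.isChain_append] at this
    exact this.2.2 z (by simp [List.getLast?_cons]) _ (by simp)
  rcases PartialGraph.eq_or_eq_of_inc hzc hcb hne.symm (w := v) (by simp [hc]) with rfl | rfl
  · rw [hz] at hl
    exact key _ hl
  · have := hl.reverse PartialGraph.Inc.symm
    rw [List.reverse_cons] at this
    exact key _ this

/-- At a vertex other than ⅋ all colours are distinct, so no cycle at all can pass through it. -/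
theorem NoCuspFreeCycleAt.isSplitting (hac : ρ.DirectedAcyclic) {v : ρ.V}
    (hv : ρ.NoCuspFreeCycleAt v) : ρ.IsSplitting v := by
  by_cases hr : ρ.rule v = .parr
  · refine Or.inr ⟨hr, fun c hc u p hp hcp => ?_⟩
    rw [← PartialGraph.Path.inr_mem_nodes] at hcp
    obtain ⟨l, hl⟩ := hp.exists_isCyc hcp
    exact hv.conclusion hac hc l hl
  · refine Or.inl ⟨hr, fun u p hp hvp => ?_⟩
    rw [← PartialGraph.Path.inl_mem_nodes] at hvp
    obtain ⟨l, hl⟩ := hp.exists_isCyc hvp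
    have h2 := hl.two_le
    have hl0 : l ≠ [] := by rintro rfl; simp at h2
    have h₁ := hv l hl _ (List.head?_eq_some_head hl0) _ (List.getLast?_eq_some_getLast hl0)
    rw [colour_eq_of_not_parr hr, colour_eq_of_not_parr hr] at h₁
    exact hl.head_ne_last (List.head?_eq_some_head hl0) (List.getLast?_eq_some_getLast hl0) h₁

/-- A state is a vertex with one of its premises. -/
def states (ρ : LabeledGraph Atom) : Set ((ρ.V ⊕ ρ.E) × (ρ.V ⊕ ρ.E)) :=
  {s | ∃ v e, s = (.inl v, .inr e) ∧ ρ.tgt e = some v}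

/-- The two edges of the cycle at `v` have different colours, so the cycle or its reverse leaves `v`
with a colour other than that of `a`. The hop given by `exists_hop` ends at a cusp, that is, at a
⅋-vertex entered by a premise, which is a state. -/
theorem exists_hop_of_isCyc (hac : ρ.DRCorrect) {v : ρ.V} {a : ρ.E}
    {l : List (ρ.V ⊕ ρ.E)} (hl : IsCyc ρ.Inc (.inl v) l)
    (h : ∀ b ∈ l.head?, ∀ z ∈ l.getLast?, ρ.colour (.inl v) b ≠ ρ.colour (.inl v) z) :
    ∃ t ∈ ρ.states, Hop ρ.Inc ρ.colour (.inl v, .inr a) t := by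
  have key : ∀ l, IsCyc ρ.Inc (.inl v) l →
      (∀ b ∈ l.head?, ρ.colour (.inl v) (.inr a) ≠ ρ.colour (.inl v) b ∧
        ∀ z ∈ l.getLast?, ρ.colour (.inl v) z ≠ ρ.colour (.inl v) b) →
      ∃ t ∈ ρ.states, Hop ρ.Inc ρ.colour (.inl v, .inr a) t := by
    intro l hl hs
    obtain ⟨u, e, f, hhop, heu, hef, hκ⟩ := exists_hop (κ := ρ.colour) PartialGraph.Inc.symm
      (Set.range Sum.inl) (fun x a c h hac => by
        obtain ⟨v, rfl⟩ := exists_vertex_of_colour_eq h hac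
        exact ⟨v, rfl⟩)
      (by rintro _ ⟨v, rfl⟩ l hl hx; exact hac.cusps_ne_zero hl hx) ⟨v, rfl⟩ hl hs
    refine ⟨(u, e), ?_, hhop⟩
    obtain ⟨w, rfl⟩ := exists_vertex_of_colour_eq hκ hef
    rcases e with e | e
    · simp at heu
    rcases f with f | f
    · classical
      rw [colour_inl_inr, colour_inl_inl] at hκ
      split_ifs at hκ with hh
      exact ⟨w, e, rfl, hh.2⟩
    · obtain ⟨_, _, _, ⟨⟩, ⟨⟩, -, -, ht, -⟩ := colour_eq_colour hκ hef (by simp) (by simp)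
      exact ⟨_, _, rfl, ht⟩
  by_cases hs : ∀ b ∈ l.head?, ρ.colour (.inl v) (.inr a) ≠ ρ.colour (.inl v) b
  · exact key l hl fun b hb => ⟨hs b hb, fun z hz => (h b hb z hz).symm⟩
  · push Not at hs
    obtain ⟨b, hb, hab⟩ := hs
    refine key _ (hl.reverse PartialGraph.Inc.symm) fun z hz => ?_
    rw [List.head?_reverse] at hz
    rw [List.getLast?_reverse]
    exact ⟨hab ▸ h b hb z hz, fun b' hb' => h b' hb' z hz⟩

/-- Coming back from `w` to `v` would close a cycle through `c`. Coming back to `c` first is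
impossible: `c` is reached only from `v`, or from `w` with the excluded colour. -/
theorem exists_hop_of_conclusion (hac : ρ.DirectedAcyclic) {v w : ρ.V} {a c : ρ.E}
    (hc : ∀ l, ¬ IsCyc ρ.Inc (.inr c) l) (ha : ρ.tgt a = some v) (hcv : ρ.src c = some v)
    (hcw : ρ.tgt c = some w) : Hop ρ.Inc ρ.colour (.inl v, .inr a) (.inl w, .inr c) := by
  classical
  have hvw : v ≠ w := by
    rintro rfl
    exact src_ne_tgt hac hcv hcw
  have hca : c ≠ a := by
    rintro rfl
    exact src_ne_tgt hac hcv ha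
  refine ⟨[.inr c], ⟨?_, ?_, ?_, ?_, ?_⟩, ?_⟩
  · simp [hcv, hcw]
  · simp [hvw]
  · simp [cusps, cuspAt, hvw]
  · simp only [List.cons_append, List.head?_cons, Option.mem_some_iff, forall_eq']
    rw [colour_inl_inr, colour_inl_inr, if_neg (c := _ ∧ ρ.tgt c = some v)]
    · split_ifs <;> simp [hca.symm]
    · rintro ⟨-, h⟩
      rw [hcw] at h
      exact hvw (Option.some.inj h).symm
  · simp
  · intro R₀ y₀ f₀ hR₀ hy₀
    obtain ⟨R, y, f, hR, hy, hfirst⟩ := hR₀.exists_prefix (· ∈ [Sum.inl v, Sum.inr c])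
      ⟨y₀, by simp, hy₀⟩
    simp only at hR
    have hchain := hR.chain
    have hnd := hR.nodup
    have hy : y = .inl v ∨ y = .inr c := by simpa using hy
    rcases hy with rfl | rfl
    · refine hc (.inl w :: R ++ [.inl v]) ⟨?_, ?_, by simp⟩
      · rw [List.isChain_append]
        refine ⟨?_, by simp, ?_⟩
        · rw [List.cons_append, List.isChain_cons_cons]
          exact ⟨by simp [hcw], hchain⟩
        · intro z hz z' hz'
          have e₁ : z = .inl v := by
            rw [← List.cons_append, List.getLast?_concat] at hz
            exact (Option.some.inj hz).symm
          have e₂ : z' = .inr c := by simpa using hz'.symm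
          subst e₁ e₂
          simp [hcv]
      · rw [List.nodup_cons]
        refine ⟨?_, hnd⟩
        intro hmem
        have : Sum.inr c ∈ R := by simpa using hmem
        exact hfirst _ this (by simp)
    · rcases List.eq_nil_or_concat R with rfl | ⟨R', z, rfl⟩
      · have := hR.start (.inr c) (by simp)
        exact this rfl
      · have hz : z ∈ R'.concat z := by simp
        have hzc : ρ.Inc z (.inr c) := by
          rw [List.isChain_append] at hchain
          exact hchain.2.2 z (by simp [List.getLast?_cons]) _ (by simp)
        rcases z with z | z
        · have : z = v ∨ z = w := by
            simp [hcv, hcw] at hzc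
            tauto
          rcases this with rfl | rfl
          · exact hfirst _ hz (by simp)
          · simp at hnd
        · simp at hzc

/-- A proof net with at least one vertex has a splitting vertex whose conclusions have no target. -/
theorem IsProofNet.exists_terminal_splitting (hρ : ρ.IsProofNet) (hV : Nonempty ρ.V) :
    ∃ v, ρ.IsSplitting v ∧ ∀ c, ρ.src c = some v → ρ.tgt c = none := by
  have hps := hρ.isProofStructure
  have := hps.finite_V
  have := hps.finite_E
  by_cases hT : ρ.states.Nonempty
  · obtain ⟨s, ⟨v, a, rfl, ha⟩, hmax⟩ := exists_maximal (Adj := ρ.Inc) (κ := ρ.colour) _ hT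
    have hv : ρ.NoCuspFreeCycleAt v := by
      intro l hl
      by_contra! h
      obtain ⟨b, hb, z, hz, hbz⟩ := h
      obtain ⟨t, ht, hh⟩ := exists_hop_of_isCyc (a := a) hρ.drCorrect hl (by
        intro b' hb' z' hz'
        rw [Option.mem_unique hb' hb, Option.mem_unique hz' hz]
        exact hbz)
      exact hmax t ht hh
    refine ⟨v, hv.isSplitting hps.acyclic, fun c hc => ?_⟩
    by_contra hne
    obtain ⟨w, hw⟩ := Option.ne_none_iff_exists'.1 hne
    exact hmax _ ⟨w, c, rfl, hw⟩
      (exists_hop_of_conclusion hps.acyclic (hv.conclusion hps.acyclic hc) ha hc hw)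
  -- Without states no edge has a target, so no two vertices are joined and there is no cycle.
  · have hT' : ∀ e, ρ.tgt e = none := by
      intro e
      by_contra hne
      obtain ⟨w, hw⟩ := Option.ne_none_iff_exists'.1 hne
      exact hT ⟨_, w, e, rfl, hw⟩
    obtain ⟨v⟩ := hV
    refine ⟨v, ?_, fun c _ => hT' c⟩
    have hnc : ∀ (u : ρ.V) (p : ρ.toPartialGraph.Path u u), ¬ p.IsCycle := by
      rintro u (_ | ⟨e, h, p⟩) hp
      · exact hp.1 rfl
      · have := h.2
        simp [hT'] at this
    by_cases hr : ρ.rule v = .parr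
    · exact Or.inr ⟨hr, fun c _ u p hp => absurd hp (hnc u p)⟩
    · exact Or.inl ⟨hr, fun u p hp => absurd hp (hnc u p)⟩

end LabeledGraph

/-! ### Restriction of a net to a part. -/

open Classical in
/-- Restriction of a partially defined element to a subset. -/
noncomputable def restrictOption {α : Type*} (P : Set α) (o : Option α) : Option P :=
  o.bind fun v => if h : v ∈ P then some ⟨v, h⟩ else none

section restrictOption

variable {α : Type*} {P : Set α}

@[simp] theorem restrictOption_none : restrictOption P none = none := rfl

theorem restrictOption_of_mem {v : α} (h : v ∈ P) : restrictOption P (some v) = some ⟨v, h⟩ := by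
  simp [restrictOption, h]

theorem restrictOption_of_notMem {v : α} (h : v ∉ P) : restrictOption P (some v) = none := by
  simp [restrictOption, h]

@[simp] theorem restrictOption_eq_some {o : Option α} {v : P} :
    restrictOption P o = some v ↔ o = some v.1 := by
  rcases o with _ | w
  · simp
  · by_cases h : w ∈ P
    · simp [restrictOption_of_mem h, Subtype.ext_iff]
    · simp only [restrictOption_of_notMem h, reduceCtorEq, Option.some.injEq, false_iff]
      rintro rfl
      exact h v.2

theorem restrictOption_eq_none {o : Option α} :
    restrictOption P o = none ↔ ∀ v, o = some v → v ∉ P := by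
  rcases o with _ | w
  · simp
  · by_cases h : w ∈ P
    · simp [restrictOption_of_mem h, h]
    · simp [restrictOption_of_notMem h, h]

end restrictOption

namespace PartialGraph.Path

/-- The image of a path under a map of graphs. -/
def map {G H : PartialGraph} (f : G.V → H.V) (g : G.E → H.E)
    (h : ∀ e u v, G.Joins e u v → H.Joins (g e) (f u) (f v)) :
    {u v : G.V} → G.Path u v → H.Path (f u) (f v)
  | _, _, nil v => nil (f v)
  | _, _, cons e he p => cons (g e) (h _ _ _ he) (map f g h p)

variable {G H : PartialGraph} {f : G.V → H.V} {g : G.E → H.E}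
  {h : ∀ e u v, G.Joins e u v → H.Joins (g e) (f u) (f v)}

theorem edges_map {u v : G.V} : ∀ p : G.Path u v, (p.map f g h).edges = p.edges.map g
  | nil _ => rfl
  | cons e _ p => by simp [map, edges, edges_map p]

theorem vertices_map {u v : G.V} : ∀ p : G.Path u v, (p.map f g h).vertices = p.vertices.map f
  | nil _ => rfl
  | cons e _ p => by simp [map, vertices, vertices_map p]

theorem IsCycle.map {u : G.V} {p : G.Path u u} (hp : p.IsCycle) (hf : f.Injective)
    (hg : g.Injective) : (p.map f g h).IsCycle := by
  obtain ⟨h₁, h₂, h₃⟩ := hp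
  refine ⟨by simpa [edges_map] using h₁, ?_, ?_⟩
  · rw [edges_map]; exact h₂.map hg
  · rw [vertices_map, ← List.map_tail]; exact h₃.map hf

theorem exists_tgt_of_mem_edges {u v : G.V} {e : G.E} : ∀ p : G.Path u v, e ∈ p.edges →
    ∃ w, G.tgt e = some w
  | nil _, h => by simp [edges] at h
  | cons e' he p, h => by
    rcases List.mem_cons.1 h with rfl | h
    · rcases he.2 with h | h
      · exact ⟨_, h.2⟩
      · exact ⟨_, h.2⟩
    · exact exists_tgt_of_mem_edges p h

end PartialGraph.Path

theorem PartialGraph.incident_disconnect {G : PartialGraph} {S : Set G.E} {v : G.V} {e : G.E} :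
    (G.disconnect S).Incident (.inl v) (.inr e) ↔
      G.src e = some v ∨ e ∉ S ∧ G.tgt e = some v := by
  simp only [Incident]
  by_cases h : e ∈ S <;> simp [h]

namespace LabeledGraph

variable {Atom : Type*} {ρ : LabeledGraph Atom}

/-- The labeled graph with vertices `P` and edges `Q`. -/
@[reducible] noncomputable def restrict (ρ : LabeledGraph Atom) (P : Set ρ.V) (Q : Set ρ.E) :
    LabeledGraph Atom where
  V := P
  E := Q
  src e := restrictOption P (ρ.src e)
  tgt e := restrictOption P (ρ.tgt e)
  rule v := ρ.rule v
  type e := ρ.type e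

/-- A part of a labeled graph, which can be cut from the rest at the targets of edges only. -/
structure IsPart (ρ : LabeledGraph Atom) (P : Set ρ.V) (Q : Set ρ.E) : Prop where
  src_mem : ∀ ⦃e v⦄, e ∈ Q → ρ.src e = some v → v ∈ P
  mem_of_src : ∀ ⦃e v⦄, v ∈ P → ρ.src e = some v → e ∈ Q
  mem_of_tgt : ∀ ⦃e v⦄, v ∈ P → ρ.tgt e = some v → e ∈ Q

namespace IsPart

variable {P : Set ρ.V} {Q : Set ρ.E}

theorem restrict_src (h : ρ.IsPart P Q) (e : Q) :
    (restrictOption P (ρ.src e)).map Subtype.val = ρ.src e := by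
  rcases hs : ρ.src e with _ | v
  · simp
  · rw [restrictOption_of_mem (h.src_mem e.2 hs)]; rfl

theorem isInitial_restrict (h : ρ.IsPart P Q) (e : Q) :
    (ρ.restrict P Q).IsInitial e ↔ ρ.IsInitial e := by
  unfold IsInitial
  refine or_congr ?_ ?_
  · rw [restrictOption_eq_none]
    constructor
    · intro h'
      by_contra hne
      obtain ⟨v, hv⟩ := Option.ne_none_iff_exists'.1 hne
      exact h' v hv (h.src_mem e.2 hv)
    · intro h' v hv
      rw [h'] at hv
      cases hv
  · constructor
    · rintro ⟨v, hv, hr⟩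
      exact ⟨v, restrictOption_eq_some.1 hv, hr⟩
    · rintro ⟨v, hv, hr⟩
      exact ⟨⟨v, h.src_mem e.2 hv⟩, restrictOption_eq_some.2 hv, hr⟩

/-- A part keeps the sources of its edges, so no edge becomes initial and no inner tag becomes new.
This is why parts are cut at targets only. -/
theorem newLocs_restrict (h : ρ.IsPart P Q) (e : Q) :
    (ρ.restrict P Q).newLocs e = ρ.newLocs e := by
  unfold newLocs
  simp only [h.isInitial_restrict]

theorem mem_premises_restrict (v : P) (e : Q) :
    e ∈ (ρ.restrict P Q).premises v ↔ e.1 ∈ ρ.premises v := restrictOption_eq_some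

theorem mem_conclusions_restrict (v : P) (e : Q) :
    e ∈ (ρ.restrict P Q).conclusions v ↔ e.1 ∈ ρ.conclusions v := restrictOption_eq_some

theorem localConstraint (h : ρ.IsPart P Q) (v : P) (hv : ρ.LocalConstraint v) :
    (ρ.restrict P Q).LocalConstraint v := by
  have hp : (ρ.restrict P Q).premises v = Subtype.val ⁻¹' ρ.premises v := by
    ext e; exact mem_premises_restrict v e
  have hc : (ρ.restrict P Q).conclusions v = Subtype.val ⁻¹' ρ.conclusions v := by
    ext e; exact mem_conclusions_restrict v e
  have hpQ : ∀ e ∈ ρ.premises v, e ∈ Q := fun e he => h.mem_of_tgt v.2 he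
  have hcQ : ∀ e ∈ ρ.conclusions v, e ∈ Q := fun e he => h.mem_of_src v.2 he
  have pair : ∀ (e f : ρ.E) (he : e ∈ Q) (hf : f ∈ Q),
      (Subtype.val ⁻¹' {e, f} : Set Q) = {⟨e, he⟩, ⟨f, hf⟩} := by
    intro e f he hf
    ext x
    simp [Subtype.ext_iff]
  have single : ∀ (e : ρ.E) (he : e ∈ Q), (Subtype.val ⁻¹' {e} : Set Q) = {⟨e, he⟩} := by
    intro e he
    ext x
    simp [Subtype.ext_iff]
  unfold LocalConstraint at hv ⊢
  rw [hp, hc]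
  change match ρ.rule v with | .ax => _ | .cut => _ | .tensor => _ | .parr => _
  rcases hr : ρ.rule v <;> simp only [hr] at hv ⊢
  · obtain ⟨h₁, e, f, hef, h₂, hd⟩ := hv
    have he : e ∈ Q := hcQ e (by simp [h₂])
    have hf : f ∈ Q := hcQ f (by simp [h₂])
    refine ⟨by simp [h₁], ⟨e, he⟩, ⟨f, hf⟩, by simpa using hef, ?_, hd⟩
    rw [h₂, pair]
  · obtain ⟨h₁, e, f, hef, h₂, hd⟩ := hv
    have he : e ∈ Q := hpQ e (by simp [h₂])
    have hf : f ∈ Q := hpQ f (by simp [h₂])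
    refine ⟨by simp [h₁], ⟨e, he⟩, ⟨f, hf⟩, by simpa using hef, ?_, hd⟩
    rw [h₂, pair]
  all_goals
    obtain ⟨e, f, c, l, hef, h₁, h₂, ht⟩ := hv
    have he : e ∈ Q := hpQ e (by simp [h₁])
    have hf : f ∈ Q := hpQ f (by simp [h₁])
    have hc : c ∈ Q := hcQ c (by simp [h₂])
    refine ⟨⟨e, he⟩, ⟨f, hf⟩, ⟨c, hc⟩, l, by simpa using hef, ?_, ?_, ht⟩
    · rw [h₁, pair]
    · rw [h₂, single]

theorem isProofStructure (h : ρ.IsPart P Q) (hρ : ρ.IsProofStructure) :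
    (ρ.restrict P Q).IsProofStructure := by
  have := hρ.finite_V
  have := hρ.finite_E
  refine ⟨inferInstanceAs (Finite P), inferInstanceAs (Finite Q), ?_,
    fun v => h.localConstraint v (hρ.local_constraint v), fun e => hρ.wellTagged e, ?_⟩
  · intro v hv
    refine hρ.acyclic v.1 (Relation.TransGen.lift Subtype.val ?_ _ _ hv)
    rintro u w ⟨e, h₁, h₂⟩
    exact ⟨e.1, restrictOption_eq_some.1 h₁, restrictOption_eq_some.1 h₂⟩
  · intro e f hef
    rw [h.newLocs_restrict, h.newLocs_restrict]
    exact hρ.disjoint_locs _ _ (by simpa [Subtype.ext_iff] using hef)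

theorem isProofNet (h : ρ.IsPart P Q) (hρ : ρ.IsProofNet) : (ρ.restrict P Q).IsProofNet := by
  refine ⟨h.isProofStructure hρ.isProofStructure, ?_⟩
  intro v p hp hsw
  have hj : ∀ (e : Q) (u v : P), (ρ.restrict P Q).Joins e u v → ρ.Joins e u v := by
    rintro e u v ⟨hne, h'⟩
    refine ⟨by simpa [Subtype.ext_iff] using hne, ?_⟩
    simpa using h'
  refine hρ.drCorrect v (p.map Subtype.val Subtype.val hj)
    (hp.map Subtype.val_injective Subtype.val_injective) ?_
  rintro w hw e f he hf hef ⟨hep, hfp⟩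
  rw [PartialGraph.Path.edges_map, List.mem_map] at hep hfp
  obtain ⟨e, hep, rfl⟩ := hep
  obtain ⟨f, hfp, rfl⟩ := hfp
  -- Edges of the path keep their target in the restriction, so `w` is a vertex of the part.
  obtain ⟨w', hw'⟩ := p.exists_tgt_of_mem_edges hep
  have hw'' := restrictOption_eq_some.1 hw'
  obtain rfl : w'.1 = w := Option.some.inj (hw''.symm.trans he)
  exact hsw w' hw e f ((mem_premises_restrict _ _).2 he) ((mem_premises_restrict _ _).2 hf)
    (by rintro rfl; exact hef rfl) ⟨hep, hfp⟩

theorem isClosed (h : ρ.IsPart P Q) (hρ : ρ.IsClosed) : (ρ.restrict P Q).IsClosed := by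
  intro e he
  apply hρ e
  rw [← h.restrict_src e]
  exact congrArg _ he

/-- If `g` is the only edge of a part that joins it to the rest of a correctness graph, then the part
is connected if the whole is. -/
theorem isConnected (h : ρ.IsPart P Q) {S : Set ρ.E} (hS : ρ.IsChoice S)
    (hcard : (ρ.toPartialGraph.disconnect S).numComponents = 1) {g : ρ.E} (hg : g ∈ Q)
    (hgS : ∀ e ∈ Q, ∀ v ∉ P, ρ.tgt e = some v → e ∉ S → e = g) :
    (ρ.restrict P Q).IsConnected := by
  classical
  -- An edge of `S` whose target is outside `P` is a conclusion of the part, hence cannot belong to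
  -- a choice for it.
  refine ⟨{e | e.1 ∈ S ∧ ∃ v ∈ P, ρ.tgt e.1 = some v}, ⟨?_, ?_⟩, ?_⟩
  · rintro e ⟨he, v, hv, hev⟩
    obtain ⟨w, hw, hew⟩ := hS.1 _ he
    obtain rfl : v = w := Option.some.inj (hev.symm.trans hew)
    exact ⟨⟨v, hv⟩, hw, (mem_premises_restrict _ _).2 hew⟩
  · intro v hv
    obtain ⟨e, ⟨heS, hev⟩, hu⟩ := hS.2 v hv
    refine ⟨⟨e, h.mem_of_tgt v.2 hev⟩, ⟨⟨heS, v, v.2, hev⟩, (mem_premises_restrict _ _).2 hev⟩, ?_⟩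
    rintro f ⟨⟨hfS, -⟩, hfv⟩
    exact Subtype.ext (hu _ ⟨hfS, (mem_premises_restrict _ _).1 hfv⟩)
  · set S' : Set Q := {e | e.1 ∈ S ∧ ∃ v ∈ P, ρ.tgt e.1 = some v} with hS'
    unfold PartialGraph.numComponents at hcard ⊢
    rw [Nat.card_eq_one_iff_unique] at hcard ⊢
    let R := ((ρ.restrict P Q).toPartialGraph.disconnect S').Incident
    -- Everything outside the part is sent to the class of `g`, the only edge that still crosses the
    -- boundary. So `φ` is constant on components, and on the part it is the quotient map.
    let φ : ρ.V ⊕ ρ.E → Quot R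
      | .inl v => if hv : v ∈ P then Quot.mk R (.inl ⟨v, hv⟩) else Quot.mk R (.inr ⟨g, hg⟩)
      | .inr e => if he : e ∈ Q then Quot.mk R (.inr ⟨e, he⟩) else Quot.mk R (.inr ⟨g, hg⟩)
    have hφ : ∀ a b, (ρ.toPartialGraph.disconnect S).Incident a b → φ a = φ b := by
      rintro (v | e) (w | f) hab
      · exact hab.elim
      · rw [PartialGraph.incident_disconnect] at hab
        by_cases hv : v ∈ P
        · have hf : f ∈ Q := by
            rcases hab with h' | h'
            · exact h.mem_of_src hv h'
            · exact h.mem_of_tgt hv h'.2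
          simp only [φ, dif_pos hv, dif_pos hf]
          refine Quot.sound ?_
          refine PartialGraph.incident_disconnect.2 ?_
          rcases hab with h' | ⟨h₁, h₂⟩
          · exact Or.inl (restrictOption_eq_some.2 h')
          · exact Or.inr ⟨fun h => h₁ h.1, restrictOption_eq_some.2 h₂⟩
        · by_cases hf : f ∈ Q
          · rcases hab with h' | ⟨h₁, h₂⟩
            · exact absurd (h.src_mem hf h') hv
            · obtain rfl := hgS f hf v hv h₂ h₁
              simp [φ, hv, hf]
          · simp [φ, hv, hf]
      · exact hab.elim
      · exact hab.elim
    have hval : ∀ x : P ⊕ Q, φ (Sum.map Subtype.val Subtype.val x) = Quot.mk R x := by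
      rintro (x | x)
      · simp [φ]
      · simp [φ]
    have hsub := hcard.1
    refine ⟨⟨?_⟩, ⟨Quot.mk _ (.inr ⟨g, hg⟩)⟩⟩
    rintro ⟨x⟩ ⟨y⟩
    change Quot.mk R x = Quot.mk R y
    rw [← hval x, ← hval y]
    exact congrArg (Quot.lift φ hφ) (Subsingleton.elim (Quot.mk _ _) (Quot.mk _ _))

end IsPart

/-! ### Unions of components and isomorphisms. -/

/-- A union of connected components. -/
structure IsComponentUnion (ρ : LabeledGraph Atom) (P : Set ρ.V) (Q : Set ρ.E) : Prop where
  src_iff : ∀ ⦃e v⦄, ρ.src e = some v → (e ∈ Q ↔ v ∈ P)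
  tgt_iff : ∀ ⦃e v⦄, ρ.tgt e = some v → (e ∈ Q ↔ v ∈ P)

theorem IsComponentUnion.isPart {P : Set ρ.V} {Q : Set ρ.E} (h : ρ.IsComponentUnion P Q) :
    ρ.IsPart P Q :=
  ⟨fun _ _ he hv => (h.src_iff hv).1 he, fun _ _ hv he => (h.src_iff he).2 hv,
    fun _ _ hv he => (h.tgt_iff he).2 hv⟩

theorem IsComponentUnion.compl {P : Set ρ.V} {Q : Set ρ.E} (h : ρ.IsComponentUnion P Q) :
    ρ.IsComponentUnion Pᶜ Qᶜ :=
  ⟨fun _ _ hv => not_congr (h.src_iff hv), fun _ _ hv => not_congr (h.tgt_iff hv)⟩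

/-- Disconnecting edges only removes incidences, so membership is still constant on the components
of a correctness graph. -/
theorem IsComponentUnion.not_isConnected {P : Set ρ.V} {Q : Set ρ.E}
    (h : ρ.IsComponentUnion P Q) {x y : ρ.V ⊕ ρ.E} (hx : Sum.elim P Q x) (hy : ¬ Sum.elim P Q y) :
    ¬ ρ.IsConnected := by
  classical
  rintro ⟨S, -, hcard⟩
  unfold PartialGraph.numComponents at hcard
  rw [Nat.card_eq_one_iff_unique] at hcard
  have hsub := hcard.1
  have hφ : ∀ a b, (ρ.toPartialGraph.disconnect S).Incident a b →
      Sum.elim P Q a = Sum.elim P Q b := by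
    rintro (v | e) (w | f) hab
    · exact hab.elim
    · apply propext
      rcases PartialGraph.incident_disconnect.1 hab with h' | ⟨-, h'⟩
      · exact (h.src_iff h').symm
      · exact (h.tgt_iff h').symm
    · exact hab.elim
    · exact hab.elim
  have := congrArg (Quot.lift _ hφ) (Subsingleton.elim (Quot.mk _ x) (Quot.mk _ y))
  change Sum.elim P Q x = Sum.elim P Q y at this
  rw [this] at hx
  exact hy hx

namespace Iso

/-- The inverse of an isomorphism. -/
def symm {ρ σ : LabeledGraph Atom} (i : ρ.Iso σ) : σ.Iso ρ where
  onV := i.onV.symm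
  onE := i.onE.symm
  src_eq e := by
    have := i.src_eq (i.onE.symm e)
    rw [Equiv.apply_symm_apply] at this
    rw [this, Option.map_map, Equiv.symm_comp_self, Option.map_id]
    rfl
  tgt_eq e := by
    have := i.tgt_eq (i.onE.symm e)
    rw [Equiv.apply_symm_apply] at this
    rw [this, Option.map_map, Equiv.symm_comp_self, Option.map_id]
    rfl
  rule_eq v := by
    have := i.rule_eq (i.onV.symm v)
    simpa using this.symm
  type_eq e := by
    have := i.type_eq (i.onE.symm e)
    simpa using this.symm

/-- The composition of isomorphisms. -/
def trans {ρ σ τ : LabeledGraph Atom} (i : ρ.Iso σ) (j : σ.Iso τ) : ρ.Iso τ where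
  onV := i.onV.trans j.onV
  onE := i.onE.trans j.onE
  src_eq e := by simp [j.src_eq, i.src_eq]
  tgt_eq e := by simp [j.tgt_eq, i.tgt_eq]
  rule_eq v := by simp [j.rule_eq, i.rule_eq]
  type_eq e := by simp [j.type_eq, i.type_eq]

/-- Disjoint union preserves isomorphisms. -/
def disjUnion {ρ σ ρ' σ' : LabeledGraph Atom} (i : ρ.Iso ρ') (j : σ.Iso σ') :
    (ρ.disjUnion σ).Iso (ρ'.disjUnion σ') where
  onV := Equiv.sumCongr i.onV j.onV
  onE := Equiv.sumCongr i.onE j.onE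
  src_eq := by
    rintro (e | e)
    · simp [i.src_eq, Function.comp_def]
    · simp [j.src_eq, Function.comp_def]
  tgt_eq := by
    rintro (e | e)
    · simp [i.tgt_eq, Function.comp_def]
    · simp [j.tgt_eq, Function.comp_def]
  rule_eq := by
    rintro (e | e)
    · simp [i.rule_eq]
    · simp [j.rule_eq]
  type_eq := by
    rintro (e | e)
    · simp [i.type_eq]
    · simp [j.type_eq]

theorem isActive_iff {ρ σ : LabeledGraph Atom} (i : ρ.Iso σ) (A B : LFormula Atom) (e : ρ.E) :
    (σ.tgt (i.onE e) = none ∧ (σ.type (i.onE e) = A ∨ σ.type (i.onE e) = B)) ↔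
      (ρ.tgt e = none ∧ (ρ.type e = A ∨ ρ.type e = B)) := by
  rw [i.tgt_eq, i.type_eq, Option.map_eq_none_iff]

/-- Adding a cut preserves isomorphisms. -/
noncomputable def addCut {ρ σ : LabeledGraph Atom} (i : ρ.Iso σ) (A B : LFormula Atom) :
    (ρ.addCut A B).Iso (σ.addCut A B) where
  onV := Equiv.optionCongr i.onV
  onE := i.onE
  src_eq e := by simp [i.src_eq, Function.comp_def]
  tgt_eq e := by
    by_cases h : ρ.tgt e = none ∧ (ρ.type e = A ∨ ρ.type e = B)
    · simp only [if_pos h, if_pos ((i.isActive_iff A B e).2 h)]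
      rfl
    · simp only [if_neg h, if_neg (mt (i.isActive_iff A B e).1 h), i.tgt_eq e]
      simp [Function.comp_def]
  rule_eq := by
    rintro (_ | v)
    · simp
    · simp [i.rule_eq]
  type_eq e := by simp [i.type_eq]

/-- Adding a link preserves isomorphisms. -/
noncomputable def addLink {ρ σ : LabeledGraph Atom} (i : ρ.Iso σ) (r : Rule) (A B C : LFormula Atom) :
    (ρ.addLink r A B C).Iso (σ.addLink r A B C) where
  onV := Equiv.optionCongr i.onV
  onE := Equiv.optionCongr i.onE
  src_eq := by
    rintro (_ | e)
    · simp
    · simp [i.src_eq, Function.comp_def]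
  tgt_eq := by
    rintro (_ | e)
    · simp
    · simp only [Equiv.optionCongr_apply, Option.map_some, Option.elim_some]
      by_cases h : ρ.tgt e = none ∧ (ρ.type e = A ∨ ρ.type e = B)
      · simp only [if_pos h, if_pos ((i.isActive_iff A B e).2 h)]
        rfl
      · simp only [if_neg h, if_neg (mt (i.isActive_iff A B e).1 h), i.tgt_eq e]
        simp [Function.comp_def]
  rule_eq := by
    rintro (_ | v)
    · simp
    · simp [i.rule_eq]
  type_eq := by
    rintro (_ | e)
    · simp
    · simp [i.type_eq]

end Iso

theorem IsComponentUnion.nonempty_iso {P : Set ρ.V} {Q : Set ρ.E} (h : ρ.IsComponentUnion P Q) :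
    Nonempty (ρ.Iso ((ρ.restrict P Q).disjUnion (ρ.restrict Pᶜ Qᶜ))) := by
  classical
  refine ⟨Iso.symm ⟨Equiv.Set.sumCompl P, Equiv.Set.sumCompl Q, ?_, ?_, ?_, ?_⟩⟩
  · rintro (e | e)
    · have := h.isPart.restrict_src e
      simp only [Equiv.Set.sumCompl_apply_inl, Sum.elim_inl, Option.map_map]
      exact this.symm
    · have := h.compl.isPart.restrict_src e
      simp only [Equiv.Set.sumCompl_apply_inr, Sum.elim_inr, Option.map_map]
      exact this.symm
  · rintro (e | e)
    · simp only [Equiv.Set.sumCompl_apply_inl, Sum.elim_inl, Option.map_map]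
      rcases ht : ρ.tgt e with _ | v
      · simp
      · rw [restrictOption_of_mem ((h.tgt_iff ht).1 e.2)]; rfl
    · simp only [Equiv.Set.sumCompl_apply_inr, Sum.elim_inr, Option.map_map]
      rcases ht : ρ.tgt e with _ | v
      · simp
      · rw [restrictOption_of_mem ((h.compl.tgt_iff ht).1 e.2)]; rfl
  · rintro (v | v) <;> simp
  · rintro (v | v) <;> simp

/-! ### Removing a terminal vertex. -/

/-- Two disjoint parts, that together form the complement of the vertex `v` and of its
conclusions. -/
structure IsSplit (ρ : LabeledGraph Atom) (v : ρ.V) (P P' : Set ρ.V) (Q Q' : Set ρ.E) : Prop where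
  left : ρ.IsPart P Q
  right : ρ.IsPart P' Q'
  disjoint_V : Disjoint P P'
  disjoint_E : Disjoint Q Q'
  union_V : P ∪ P' = {w | w ≠ v}
  union_E : Q ∪ Q' = {e | ρ.src e ≠ some v}

/-- The graph obtained by removing a vertex and its conclusions. -/
@[reducible] noncomputable def remove (ρ : LabeledGraph Atom) (v : ρ.V) : LabeledGraph Atom :=
  ρ.restrict {w | w ≠ v} {e | ρ.src e ≠ some v}

theorem isPart_remove {v : ρ.V} (hv : ∀ c, ρ.src c = some v → ρ.tgt c = none) :
    ρ.IsPart {w | w ≠ v} {e | ρ.src e ≠ some v} := by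
  refine ⟨?_, ?_, ?_⟩
  · rintro e w he hw rfl
    exact he hw
  · rintro e w hw he h
    exact hw (Option.some.inj (he.symm.trans h))
  · rintro e w hw he h
    have := hv e h
    rw [he] at this
    cases this

theorem IsSplit.symm {v : ρ.V} {P P' : Set ρ.V} {Q Q' : Set ρ.E} (h : ρ.IsSplit v P P' Q Q') :
    ρ.IsSplit v P' P Q' Q :=
  ⟨h.right, h.left, h.disjoint_V.symm, h.disjoint_E.symm, Set.union_comm P P' ▸ h.union_V,
    Set.union_comm Q Q' ▸ h.union_E⟩

theorem IsSplit.tgt_eq {v w : ρ.V} {P P' : Set ρ.V} {Q Q' : Set ρ.E} (h : ρ.IsSplit v P P' Q Q')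
    {e : ρ.E} (he : e ∈ Q) (hw : ρ.tgt e = some w) (hwP : w ∉ P) : w = v := by
  by_contra hne
  have : w ∈ P ∪ P' := by rw [h.union_V]; exact hne
  rcases this with h' | h'
  · exact hwP h'
  · exact Set.disjoint_left.1 h.disjoint_E he (h.right.mem_of_tgt h' hw)

theorem IsSplit.nonempty_iso {v : ρ.V} {P P' : Set ρ.V} {Q Q' : Set ρ.E}
    (h : ρ.IsSplit v P P' Q Q') :
    Nonempty (((ρ.restrict P Q).disjUnion (ρ.restrict P' Q')).Iso (ρ.remove v)) := by
  have hP : ∀ {w}, w ∈ P → w ≠ v := fun {w} hw => by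
    have : w ∈ P ∪ P' := Or.inl hw
    rwa [h.union_V] at this
  have hP' : ∀ {w}, w ∈ P' → w ≠ v := fun {w} hw => by
    have : w ∈ P ∪ P' := Or.inr hw
    rwa [h.union_V] at this
  have hQ : ∀ {e}, e ∈ Q → ρ.src e ≠ some v := fun {e} he => by
    have : e ∈ Q ∪ Q' := Or.inl he
    rwa [h.union_E] at this
  have hQ' : ∀ {e}, e ∈ Q' → ρ.src e ≠ some v := fun {e} he => by
    have : e ∈ Q ∪ Q' := Or.inr he
    rwa [h.union_E] at this
  let fV : P ⊕ P' → {w | w ≠ v} := Sum.elim (fun w => ⟨w, hP w.2⟩) (fun w => ⟨w, hP' w.2⟩)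
  let fE : Q ⊕ Q' → {e | ρ.src e ≠ some v} :=
    Sum.elim (fun w => ⟨w, hQ w.2⟩) (fun w => ⟨w, hQ' w.2⟩)
  have hfV : fV.Bijective := by
    refine ⟨?_, ?_⟩
    · rintro (w | w) (w' | w') hww <;> simp only [fV, Sum.elim_inl, Sum.elim_inr,
        Subtype.mk.injEq, Subtype.val_inj] at hww
      · rw [hww]
      · exact (Set.disjoint_left.1 h.disjoint_V w.2 (hww ▸ w'.2)).elim
      · exact (Set.disjoint_left.1 h.disjoint_V w'.2 (hww ▸ w.2)).elim
      · rw [hww]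
    · rintro ⟨w, hw⟩
      rw [← h.union_V] at hw
      rcases hw with hw | hw
      · exact ⟨.inl ⟨w, hw⟩, rfl⟩
      · exact ⟨.inr ⟨w, hw⟩, rfl⟩
  have hfE : fE.Bijective := by
    refine ⟨?_, ?_⟩
    · rintro (w | w) (w' | w') hww <;> simp only [fE, Sum.elim_inl, Sum.elim_inr,
        Subtype.mk.injEq, Subtype.val_inj] at hww
      · rw [hww]
      · exact (Set.disjoint_left.1 h.disjoint_E w.2 (hww ▸ w'.2)).elim
      · exact (Set.disjoint_left.1 h.disjoint_E w'.2 (hww ▸ w.2)).elim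
      · rw [hww]
    · rintro ⟨w, hw⟩
      rw [← h.union_E] at hw
      rcases hw with hw | hw
      · exact ⟨.inl ⟨w, hw⟩, rfl⟩
      · exact ⟨.inr ⟨w, hw⟩, rfl⟩
  refine ⟨⟨Equiv.ofBijective fV hfV, Equiv.ofBijective fE hfE, ?_, ?_, ?_, ?_⟩⟩
  · rintro (e | e)
    · change restrictOption _ (ρ.src e) = ((restrictOption P (ρ.src e)).map Sum.inl).map fV
      rcases hs : ρ.src e with _ | w
      · simp
      · have hw := h.left.src_mem e.2 hs
        rw [restrictOption_of_mem hw, restrictOption_of_mem (show w ∈ {w | w ≠ v} from hP hw)]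
        rfl
    · change restrictOption _ (ρ.src e) = ((restrictOption P' (ρ.src e)).map Sum.inr).map fV
      rcases hs : ρ.src e with _ | w
      · simp
      · have hw := h.right.src_mem e.2 hs
        rw [restrictOption_of_mem hw, restrictOption_of_mem (show w ∈ {w | w ≠ v} from hP' hw)]
        rfl
  · rintro (e | e)
    · change restrictOption _ (ρ.tgt e) = ((restrictOption P (ρ.tgt e)).map Sum.inl).map fV
      rcases hs : ρ.tgt e with _ | w
      · simp
      · by_cases hw : w ∈ P
        · rw [restrictOption_of_mem hw, restrictOption_of_mem (show w ∈ {w | w ≠ v} from hP hw)]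
          rfl
        · have := h.tgt_eq e.2 hs hw
          rw [restrictOption_of_notMem hw, restrictOption_of_notMem (by simpa using this)]
          rfl
    · change restrictOption _ (ρ.tgt e) = ((restrictOption P' (ρ.tgt e)).map Sum.inr).map fV
      rcases hs : ρ.tgt e with _ | w
      · simp
      · by_cases hw : w ∈ P'
        · rw [restrictOption_of_mem hw, restrictOption_of_mem (show w ∈ {w | w ≠ v} from hP' hw)]
          rfl
        · have := h.symm.tgt_eq e.2 hs hw
          rw [restrictOption_of_notMem hw, restrictOption_of_notMem (by simpa using this)]
          rfl
  · rintro (w | w) <;> rfl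
  · rintro (w | w) <;> rfl

/-- The outermost tag of a type is always new at its edge. Hence `addCut` and `addLink`, which
select premises by type, find the right edges. -/
theorem IsProofStructure.type_injective (hρ : ρ.IsProofStructure) : ρ.type.Injective := by
  intro e f h
  by_contra hne
  have h₁ : (ρ.type e).tag ∈ ρ.newLocs e := Or.inl rfl
  have h₂ : (ρ.type e).tag ∈ ρ.newLocs f := Or.inl (by rw [h])
  exact Set.disjoint_left.1 (hρ.disjoint_locs e f hne) h₁ h₂

/-- The premises of `v` are the conclusions of `ρ.remove v` whose type is that of one of them. -/
theorem tgt_remove_eq (hρ : ρ.IsProofStructure) {v : ρ.V} {a b : ρ.E}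
    (hp : ρ.premises v = {a, b}) (e : {e | ρ.src e ≠ some v}) :
    (restrictOption {w | w ≠ v} (ρ.tgt e) = none ∧
      (ρ.type e = ρ.type a ∨ ρ.type e = ρ.type b)) ↔ ρ.tgt e = some v := by
  have hmem : ρ.tgt e = some v ↔ e.1 = a ∨ e.1 = b := by
    change e.1 ∈ ρ.premises v ↔ _
    rw [hp]
    simp
  rw [hρ.type_injective.eq_iff, hρ.type_injective.eq_iff, ← hmem, and_iff_right_iff_imp]
  intro h
  rw [h]
  exact restrictOption_of_notMem (by simp)

theorem map_restrictOption_ne {α : Type*} {v : α} (i : Option {w | w ≠ v} ≃ α) (hi : i none = v)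
    (hi' : ∀ w, i (some w) = w.1) (o : Option α) [Decidable (o = some v)] :
    (if o = some v then some none else (restrictOption {w | w ≠ v} o).map some).map i = o := by
  split_ifs with h
  · simp [hi, h]
  · rcases o with _ | w
    · rfl
    · have hw : w ≠ v := by rintro rfl; exact h rfl
      rw [restrictOption_of_mem (show w ∈ {w | w ≠ v} from hw)]
      simp [hi']

theorem nonempty_iso_addCut (hρ : ρ.IsProofStructure) {v : ρ.V} (hr : ρ.rule v = .cut) {a b : ρ.E}
    (hp : ρ.premises v = {a, b}) (hc : ρ.conclusions v = ∅) :
    Nonempty (((ρ.remove v).addCut (ρ.type a) (ρ.type b)).Iso ρ) := by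
  classical
  have hE : ∀ e, e ∈ {e | ρ.src e ≠ some v} := by
    intro e he
    have : e ∈ ρ.conclusions v := he
    rw [hc] at this
    exact this
  let i : Option {w | w ≠ v} ≃ ρ.V := Equiv.optionSubtypeNe v
  have hi : i none = v := Equiv.optionSubtypeNe_none v
  have hi' : ∀ w, i (some w) = w.1 := fun w => Equiv.optionSubtypeNe_some v w
  refine ⟨⟨i, Equiv.subtypeUnivEquiv hE, ?_, ?_, ?_, ?_⟩⟩
  · intro e
    have := map_restrictOption_ne i hi hi' (ρ.src e.1)
    rw [if_neg (hE e)] at this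
    exact this.symm
  · intro e
    have := map_restrictOption_ne i hi hi' (ρ.tgt e.1)
    simp only [tgt_remove_eq hρ hp]
    change ρ.tgt e.1 = _
    convert this.symm
  · rintro (_ | w)
    · change ρ.rule (i none) = .cut
      rw [hi, hr]
    · change ρ.rule (i (some w)) = ρ.rule w.1
      rw [hi']
  · intro e
    rfl

theorem nonempty_iso_addLink (hρ : ρ.IsProofStructure) {v : ρ.V} {a b c : ρ.E}
    (hp : ρ.premises v = {a, b}) (hc : ρ.conclusions v = {c}) (hct : ρ.tgt c = none) :
    Nonempty (((ρ.remove v).addLink (ρ.rule v) (ρ.type a) (ρ.type b) (ρ.type c)).Iso ρ) := by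
  classical
  have hmem : ∀ e, ρ.src e = some v ↔ e = c := by
    intro e
    change e ∈ ρ.conclusions v ↔ _
    rw [hc]
    rfl
  let i : Option {w | w ≠ v} ≃ ρ.V := Equiv.optionSubtypeNe v
  have hi : i none = v := Equiv.optionSubtypeNe_none v
  have hi' : ∀ w, i (some w) = w.1 := fun w => Equiv.optionSubtypeNe_some v w
  let k : {e | ρ.src e ≠ some v} ≃ {e // e ≠ c} :=
    Equiv.subtypeEquivRight fun e => not_congr (hmem e)
  let j : Option {e | ρ.src e ≠ some v} ≃ ρ.E :=
    (Equiv.optionCongr k).trans (Equiv.optionSubtypeNe c)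
  have hj : j none = c := Equiv.optionSubtypeNe_none c
  have hj' : ∀ e, j (some e) = e.1 := fun e => Equiv.optionSubtypeNe_some c (k e)
  refine ⟨⟨i, j, ?_, ?_, ?_, ?_⟩⟩
  · rintro (_ | e)
    · change ρ.src (j none) = some (i none)
      rw [hi, hj]
      exact (hmem c).2 rfl
    · have := map_restrictOption_ne i hi hi' (ρ.src e.1)
      rw [if_neg e.2] at this
      change ρ.src (j (some e)) = _
      rw [hj']
      exact this.symm
  · rintro (_ | e)
    · change ρ.tgt (j none) = none
      rw [hj, hct]
    · have := map_restrictOption_ne i hi hi' (ρ.tgt e.1)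
      change ρ.tgt (j (some e)) = _
      rw [hj']
      simp only [Option.elim_some, tgt_remove_eq hρ hp]
      convert this.symm
  · rintro (_ | w)
    · change ρ.rule (i none) = ρ.rule v
      rw [hi]
    · change ρ.rule (i (some w)) = ρ.rule w.1
      rw [hi']
  · rintro (_ | e)
    · change ρ.type (j none) = ρ.type c
      rw [hj]
    · change ρ.type (j (some e)) = ρ.type e.1
      rw [hj']

end LabeledGraph

/-- A node reachable from another one is reachable by a list of distinct nodes. -/
theorem exists_nodup_isChain {α : Type*} {r : α → α → Prop} {a b : α}
    (h : Relation.ReflTransGen r a b) :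
    ∃ l, (a :: l).IsChain r ∧ (a :: l).Nodup ∧ (a :: l).getLast? = some b := by
  induction h using Relation.ReflTransGen.head_induction_on with
  | refl => exact ⟨[], by simp⟩
  | @head a c hac _ ih =>
    obtain ⟨l, h₁, h₂, h₃⟩ := ih
    by_cases ha : a ∈ c :: l
    · obtain ⟨X, Y, hXY⟩ := List.append_of_mem ha
      rw [hXY] at h₁ h₂ h₃
      refine ⟨Y, (List.isChain_append.1 h₁).2.1, (List.nodup_append.1 h₂).2.1, ?_⟩
      simpa [List.getLast?_append, List.getLast?_cons] using h₃
    · exact ⟨c :: l, List.isChain_cons_cons.2 ⟨hac, h₁⟩, List.nodup_cons.2 ⟨ha, h₂⟩,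
        by rwa [List.getLast?_cons_cons]⟩

namespace LabeledGraph

variable {Atom : Type*} {ρ : LabeledGraph Atom}

/-- The two premises of a terminal splitting vertex that is not a `⅋`-vertex are in different
components of the graph without this vertex. -/
theorem IsSplitting.exists_isSplit {v : ρ.V} (hv : ρ.IsSplitting v) (hr : ρ.rule v ≠ .parr)
    (hterm : ∀ c, ρ.src c = some v → ρ.tgt c = none) {a b : ρ.E} (hab : a ≠ b)
    (ha : ρ.tgt a = some v) (hb : ρ.tgt b = some v) :
    ∃ P P' Q Q', ρ.IsSplit v P P' Q Q' ∧ a ∈ Q ∧ b ∈ Q' := by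
  -- The left part is what can be reached from `a` without entering `v`; the right part is the rest,
  -- apart from `v` and its conclusions.
  let r : ρ.V ⊕ ρ.E → ρ.V ⊕ ρ.E → Prop := fun x y => ρ.Inc x y ∧ y ≠ .inl v
  let R : ρ.V ⊕ ρ.E → Prop := Relation.ReflTransGen r (.inr a)
  have hRv : ¬ R (.inl v) := by
    intro h
    rcases Relation.ReflTransGen.cases_tail h with h | ⟨_, -, h⟩
    · cases h
    · exact h.2 rfl
  have hsrca : ρ.src a ≠ some v := fun h => by
    have := hterm a h
    rw [ha] at this
    cases this
  have hsrcb : ρ.src b ≠ some v := fun h => by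
    have := hterm b h
    rw [hb] at this
    cases this
  have hRc : ∀ c, ρ.src c = some v → ¬ R (.inr c) := by
    intro c hc h
    rcases Relation.ReflTransGen.cases_tail h with h | ⟨y, hy, h, -⟩
    · cases h
      exact hsrca hc
    · rcases y with y | y
      · have := hterm c hc
        simp only [PartialGraph.inc_inl_inr, hc, this] at h
        obtain rfl : v = y := by simpa using h
        exact hRv hy
      · simp at h
  have hstep₁ : ∀ w e, ρ.Inc (.inl w) (.inr e) → R (.inl w) → R (.inr e) :=
    fun w e h hw => hw.tail ⟨h, by simp⟩
  have hstep₂ : ∀ w e, ρ.Inc (.inl w) (.inr e) → w ≠ v → R (.inr e) → R (.inl w) :=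
    fun w e h hw he => he.tail ⟨h.symm, by simpa using hw⟩
  -- A simple path from `a` to `b` that avoids `v` would close into a cycle through `v`.
  have hRb : ¬ R (.inr b) := by
    intro h
    obtain ⟨l, h₁, h₂, h₃⟩ := exists_nodup_isChain h
    have hvl : Sum.inl v ∉ Sum.inr a :: l := by
      intro hmem
      have hmem : Sum.inl v ∈ l := by simpa using hmem
      obtain ⟨X, Y, rfl⟩ := List.append_of_mem hmem
      have : (Sum.inr a :: X ++ Sum.inl v :: Y).IsChain r := h₁
      rw [List.isChain_append] at this
      obtain ⟨z, hz⟩ : ∃ z, (Sum.inr a :: X).getLast? = some z :=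
        ⟨_, List.getLast?_eq_some_getLast (by simp)⟩
      exact (this.2.2 z hz (.inl v) (by simp)).2 rfl
    have hcyc : IsCyc ρ.Inc (.inl v) (.inr a :: l) := by
      refine ⟨?_, List.nodup_cons.2 ⟨hvl, h₂⟩, ?_⟩
      · have hc : (Sum.inr a :: l).IsChain ρ.Inc := h₁.imp fun _ _ h => h.1
        rw [List.cons_append, List.isChain_cons, List.isChain_append]
        refine ⟨?_, hc, by simp, ?_⟩
        · simp [ha]
        · intro x hx y hy
          rw [h₃] at hx
          cases hx
          obtain rfl : Sum.inl v = y := by simpa using hy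
          simp [hb]
      · cases l with
        | nil => simp [hab] at h₃
        | cons => simp
    obtain ⟨p, hp, hpl⟩ := PartialGraph.Path.exists_isCycle hcyc
    rcases hv with ⟨-, hv⟩ | ⟨h, -⟩
    · refine hv v p hp ?_
      rw [← PartialGraph.Path.inl_mem_nodes, hpl]
      simp
    · exact hr h
  refine ⟨{w | R (.inl w)}, {w | w ≠ v ∧ ¬ R (.inl w)}, {e | R (.inr e)},
    {e | ρ.src e ≠ some v ∧ ¬ R (.inr e)}, ⟨⟨?_, ?_, ?_⟩, ⟨?_, ?_, ?_⟩, ?_, ?_, ?_, ?_⟩,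
    Relation.ReflTransGen.refl, hsrcb, hRb⟩
  · intro e w he hw
    refine hstep₂ w e (by simp [hw]) ?_ he
    rintro rfl
    exact hRc e hw he
  · exact fun e w hw he => hstep₁ w e (by simp [he]) hw
  · exact fun e w hw he => hstep₁ w e (by simp [he]) hw
  · rintro e w ⟨he, he'⟩ hw
    refine ⟨by rintro rfl; exact he hw, fun h => he' (hstep₁ w e (by simp [hw]) h)⟩
  · rintro e w ⟨hw, hw'⟩ he
    refine ⟨fun h => hw (Option.some.inj (he.symm.trans h)),
      fun h => hw' (hstep₂ w e (by simp [he]) hw h)⟩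
  · rintro e w ⟨hw, hw'⟩ he
    refine ⟨fun h => ?_, fun h => hw' (hstep₂ w e (by simp [he]) hw h)⟩
    have := hterm e h
    rw [he] at this
    cases this
  · exact Set.disjoint_left.2 fun w h h' => h'.2 h
  · exact Set.disjoint_left.2 fun w h h' => h'.2 h
  · ext w
    simp only [Set.mem_union, Set.mem_ofPred_eq]
    by_cases h : R (.inl w)
    · simp only [h, true_or, true_iff]
      rintro rfl
      exact hRv h
    · simp [h]
  · ext e
    simp only [Set.mem_union, Set.mem_ofPred_eq]
    by_cases h : R (.inr e)
    · simp only [h, true_or, true_iff]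
      exact fun h' => hRc e h' h
    · simp [h]

/-! ### Each rule extends sequentializations of the parts. -/

/-- The derivation `π` sequentializes `ρ`, without the rules that `ρ` does not need. -/
structure Sequentializes (ρ : LabeledGraph Atom) (π : DerivationTree Atom) : Prop where
  isDerivation : π.IsDerivation
  iso : Nonempty (ρ.Iso π.deseq)
  locs : ∀ l ∈ π.locs, ∃ e, l ∈ ρ.newLocs e
  concl : ∀ A, A ∈ π.concl ↔ ∃ e, ρ.tgt e = none ∧ ρ.type e = A
  hypFree : ρ.IsClosed → π.HypFree
  mixFree : ρ.IsConnected → π.MixFree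

namespace Sequentializes

variable {P P' : Set ρ.V} {Q Q' : Set ρ.E} {π π' : DerivationTree Atom}

theorem exists_mem_newLocs (s : (ρ.restrict P Q).Sequentializes π) (h : ρ.IsPart P Q) {l : ℕ}
    (hl : l ∈ π.locs) : ∃ e ∈ Q, l ∈ ρ.newLocs e := by
  obtain ⟨e, he⟩ := s.locs l hl
  rw [h.newLocs_restrict] at he
  exact ⟨e, e.2, he⟩

/-- Each location of the derivation of a part is new in `ρ` at an edge of this part, and distinct
edges share no new location. -/
theorem disjoint_locs (hρ : ρ.IsProofStructure) (s : (ρ.restrict P Q).Sequentializes π)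
    (h : ρ.IsPart P Q) (s' : (ρ.restrict P' Q').Sequentializes π') (h' : ρ.IsPart P' Q')
    (hd : Disjoint Q Q') : Disjoint π.locs π'.locs := by
  rw [Finset.disjoint_left]
  intro l hl hl'
  obtain ⟨e, he, hel⟩ := s.exists_mem_newLocs h hl
  obtain ⟨e', he', hel'⟩ := s'.exists_mem_newLocs h' hl'
  refine Set.disjoint_left.1 (hρ.disjoint_locs e e' ?_) hel hel'
  rintro rfl
  exact Set.disjoint_left.1 hd he he'

theorem tag_notMem_locs (hρ : ρ.IsProofStructure) (s : (ρ.restrict P Q).Sequentializes π)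
    (h : ρ.IsPart P Q) {c : ρ.E} (hc : c ∉ Q) : (ρ.type c).tag ∉ π.locs := by
  intro hl
  obtain ⟨e, he, hel⟩ := s.exists_mem_newLocs h hl
  have hcl : (ρ.type c).tag ∈ ρ.newLocs c := Or.inl rfl
  refine Set.disjoint_left.1 (hρ.disjoint_locs e c ?_) hel hcl
  rintro rfl
  exact hc he

theorem mem_concl_iff (s : (ρ.restrict P Q).Sequentializes π) {A : LFormula Atom} :
    A ∈ π.concl ↔ ∃ e ∈ Q, (∀ v, ρ.tgt e = some v → v ∉ P) ∧ ρ.type e = A := by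
  rw [s.concl]
  constructor
  · rintro ⟨e, he, rfl⟩
    exact ⟨e, e.2, restrictOption_eq_none.1 he, rfl⟩
  · rintro ⟨e, heQ, he, rfl⟩
    exact ⟨⟨e, heQ⟩, restrictOption_eq_none.2 he, rfl⟩

/-- The conclusions of a part which are conclusions of the whole. -/
theorem mem_concl_diff_iff (hρ : ρ.IsProofStructure) (s : (ρ.restrict P Q).Sequentializes π)
    {T : Set ρ.E} (hT : ∀ e ∈ Q, e ∈ T ↔ ∃ v, ρ.tgt e = some v ∧ v ∉ P)
    {A : LFormula Atom} :
    A ∈ π.concl \ ρ.type '' T ↔ ∃ e ∈ Q, ρ.tgt e = none ∧ ρ.type e = A := by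
  rw [Set.mem_sdiff, s.mem_concl_iff]
  constructor
  · rintro ⟨⟨e, heQ, he, rfl⟩, h⟩
    refine ⟨e, heQ, ?_, rfl⟩
    by_contra hne
    obtain ⟨v, hv⟩ := Option.ne_none_iff_exists'.1 hne
    exact h ⟨e, (hT e heQ).2 ⟨v, hv, he v hv⟩, rfl⟩
  · rintro ⟨e, heQ, he, rfl⟩
    refine ⟨⟨e, heQ, by simp [he], rfl⟩, ?_⟩
    rintro ⟨f, hf, hfe⟩
    obtain rfl := hρ.type_injective hfe
    obtain ⟨v, hv, -⟩ := (hT f heQ).1 hf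
    rw [he] at hv
    cases hv

theorem mix (hρ : ρ.IsProofStructure) (h : ρ.IsComponentUnion P Q)
    (s : (ρ.restrict P Q).Sequentializes π) (s' : (ρ.restrict Pᶜ Qᶜ).Sequentializes π')
    (hconn : ¬ ρ.IsConnected) : ρ.Sequentializes (.mix₂ π π') := by
  have key : ∀ {P Q}, ρ.IsComponentUnion P Q → ∀ e ∈ Q,
      (∀ v, ρ.tgt e = some v → v ∉ P) ↔ ρ.tgt e = none := by
    intro P Q h e he
    constructor
    · intro h'
      by_contra hne
      obtain ⟨v, hv⟩ := Option.ne_none_iff_exists'.1 hne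
      exact h' v hv ((h.tgt_iff hv).1 he)
    · rintro h' v hv
      rw [h'] at hv
      cases hv
  refine ⟨⟨s.isDerivation, s'.isDerivation,
    disjoint_locs hρ s h.isPart s' h.compl.isPart disjoint_compl_right⟩, ?_, ?_, ?_, ?_, ?_⟩
  · obtain ⟨i⟩ := h.nonempty_iso
    obtain ⟨j⟩ := s.iso
    obtain ⟨j'⟩ := s'.iso
    exact ⟨i.trans (j.disjUnion j')⟩
  · intro l hl
    rcases Finset.mem_union.1 hl with hl | hl
    · obtain ⟨e, -, he⟩ := s.exists_mem_newLocs h.isPart hl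
      exact ⟨e, he⟩
    · obtain ⟨e, -, he⟩ := s'.exists_mem_newLocs h.compl.isPart hl
      exact ⟨e, he⟩
  · intro A
    change A ∈ π.concl ∪ π'.concl ↔ _
    rw [Set.mem_union, s.mem_concl_iff, s'.mem_concl_iff]
    constructor
    · rintro (⟨e, heQ, he, rfl⟩ | ⟨e, heQ, he, rfl⟩)
      · exact ⟨e, (key h e heQ).1 he, rfl⟩
      · exact ⟨e, (key h.compl e heQ).1 he, rfl⟩
    · rintro ⟨e, he, rfl⟩
      by_cases heQ : e ∈ Q
      · exact Or.inl ⟨e, heQ, (key h e heQ).2 he, rfl⟩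
      · exact Or.inr ⟨e, heQ, (key h.compl e heQ).2 he, rfl⟩
  · exact fun hc => ⟨s.hypFree (h.isPart.isClosed hc), s'.hypFree (h.compl.isPart.isClosed hc)⟩
  · exact fun hc => (hconn hc).elim

end Sequentializes

section IsSplit

variable {v : ρ.V} {P P' : Set ρ.V} {Q Q' : Set ρ.E} {π π' : DerivationTree Atom} {a b : ρ.E}

/-- An edge leaving the left part can only end at `v`, and `a` is the only premise of `v` on the
left. -/
theorem IsSplit.mem_singleton_iff (h : ρ.IsSplit v P P' Q Q') (hp : ρ.premises v = {a, b})
    (hb : b ∈ Q') (e : ρ.E) (he : e ∈ Q) :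
    e ∈ ({a} : Set ρ.E) ↔ ∃ w, ρ.tgt e = some w ∧ w ∉ P := by
  have hvP : v ∉ P := fun hv => by
    have : v ∈ P ∪ P' := Or.inl hv
    rw [h.union_V] at this
    exact this rfl
  have hmem : ρ.tgt e = some v ↔ e = a ∨ e = b := by
    change e ∈ ρ.premises v ↔ _
    rw [hp]
    rfl
  constructor
  · rintro rfl
    exact ⟨v, hmem.2 (Or.inl rfl), hvP⟩
  · rintro ⟨w, hw, hwP⟩
    obtain rfl := h.tgt_eq he hw hwP
    rcases hmem.1 hw with rfl | rfl
    · rfl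
    · exact (Set.disjoint_left.1 h.disjoint_E he hb).elim

theorem IsSplit.isConnected (h : ρ.IsSplit v P P' Q Q') (hp : ρ.premises v = {a, b})
    (ha : a ∈ Q) (hb : b ∈ Q') (hc : ρ.IsConnected) : (ρ.restrict P Q).IsConnected := by
  obtain ⟨S, hS, hcard⟩ := hc
  exact h.left.isConnected hS hcard ha fun e he w hw ht _ =>
    (h.mem_singleton_iff hp hb e he).2 ⟨w, ht, hw⟩

theorem IsSplit.mem_concl (h : ρ.IsSplit v P P' Q Q') (hp : ρ.premises v = {a, b})
    (s : (ρ.restrict P Q).Sequentializes π) (ha : a ∈ Q) (hb : b ∈ Q') :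
    ρ.type a ∈ π.concl := by
  refine s.mem_concl_iff.2 ⟨a, ha, ?_, rfl⟩
  obtain ⟨w, hw, hwP⟩ := (h.mem_singleton_iff hp hb a ha).1 rfl
  intro u hu
  rw [hw] at hu
  cases hu
  exact hwP

theorem IsSplit.mem_concl_diff_union_iff (hρ : ρ.IsProofStructure) (h : ρ.IsSplit v P P' Q Q')
    (hp : ρ.premises v = {a, b}) (s : (ρ.restrict P Q).Sequentializes π)
    (s' : (ρ.restrict P' Q').Sequentializes π') (ha : a ∈ Q) (hb : b ∈ Q') {A : LFormula Atom} :
    A ∈ (π.concl \ {ρ.type a}) ∪ (π'.concl \ {ρ.type b}) ↔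
      ∃ e, ρ.src e ≠ some v ∧ ρ.tgt e = none ∧ ρ.type e = A := by
  have h₁ := s.mem_concl_diff_iff hρ (h.mem_singleton_iff hp hb) (A := A)
  have h₂ := s'.mem_concl_diff_iff hρ
    (h.symm.mem_singleton_iff (hp.trans (Set.pair_comm a b)) ha) (A := A)
  rw [Set.image_singleton] at h₁ h₂
  rw [Set.mem_union, h₁, h₂]
  constructor
  · rintro (⟨e, he, h'⟩ | ⟨e, he, h'⟩)
    · exact ⟨e, (h.union_E ▸ Or.inl he : e ∈ {e | ρ.src e ≠ some v}), h'⟩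
    · exact ⟨e, (h.union_E ▸ Or.inr he : e ∈ {e | ρ.src e ≠ some v}), h'⟩
  · rintro ⟨e, he, h'⟩
    have : e ∈ Q ∪ Q' := by rw [h.union_E]; exact he
    exact this.imp (fun he => ⟨e, he, h'⟩) (fun he => ⟨e, he, h'⟩)

theorem Sequentializes.cut (hρ : ρ.IsProofStructure) (h : ρ.IsSplit v P P' Q Q')
    (hr : ρ.rule v = .cut) (hp : ρ.premises v = {a, b}) (hc : ρ.conclusions v = ∅)
    (hd : (ρ.type a).Dual (ρ.type b)) (s : (ρ.restrict P Q).Sequentializes π)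
    (s' : (ρ.restrict P' Q').Sequentializes π') (ha : a ∈ Q) (hb : b ∈ Q') :
    ρ.Sequentializes (.cut (ρ.type a) (ρ.type b) π π') := by
  have hp' := hp.trans (Set.pair_comm a b)
  refine ⟨⟨s.isDerivation, s'.isDerivation, disjoint_locs hρ s h.left s' h.right h.disjoint_E,
    h.mem_concl hp s ha hb, h.symm.mem_concl hp' s' hb ha, hd⟩, ?_, ?_, ?_, ?_, ?_⟩
  · obtain ⟨i⟩ := nonempty_iso_addCut hρ hr hp hc
    obtain ⟨k⟩ := h.nonempty_iso
    obtain ⟨j⟩ := s.iso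
    obtain ⟨j'⟩ := s'.iso
    exact ⟨i.symm.trans ((k.symm.trans (j.disjUnion j')).addCut _ _)⟩
  · intro l hl
    rcases Finset.mem_union.1 hl with hl | hl
    · obtain ⟨e, -, he⟩ := s.exists_mem_newLocs h.left hl
      exact ⟨e, he⟩
    · obtain ⟨e, -, he⟩ := s'.exists_mem_newLocs h.right hl
      exact ⟨e, he⟩
  · intro A
    refine (h.mem_concl_diff_union_iff hρ hp s s' ha hb).trans ?_
    refine exists_congr fun e => and_iff_right fun h => ?_
    have : e ∈ ρ.conclusions v := h
    rw [hc] at this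
    exact this
  · exact fun hc => ⟨s.hypFree (h.left.isClosed hc), s'.hypFree (h.right.isClosed hc)⟩
  · exact fun hc => ⟨s.mixFree (h.isConnected hp ha hb hc),
      s'.mixFree (h.symm.isConnected hp' hb ha hc)⟩

theorem Sequentializes.tensor (hρ : ρ.IsProofStructure) (h : ρ.IsSplit v P P' Q Q')
    (hr : ρ.rule v = .tensor) (hp : ρ.premises v = {a, b}) {c : ρ.E} (hc : ρ.conclusions v = {c})
    (hct : ρ.tgt c = none) {l : ℕ} (hl : ρ.type c = .tensor l (ρ.type a) (ρ.type b))
    (s : (ρ.restrict P Q).Sequentializes π) (s' : (ρ.restrict P' Q').Sequentializes π')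
    (ha : a ∈ Q) (hb : b ∈ Q') :
    ρ.Sequentializes (.tensor l (ρ.type a) (ρ.type b) π π') := by
  have hp' := hp.trans (Set.pair_comm a b)
  have hsrc : ∀ e, ρ.src e = some v ↔ e = c := by
    intro e
    change e ∈ ρ.conclusions v ↔ _
    rw [hc]
    rfl
  have hcQ : c ∉ Q ∪ Q' := by
    rw [h.union_E]
    exact fun h => h ((hsrc c).2 rfl)
  have hlc : (ρ.type c).tag = l := by rw [hl]; rfl
  refine ⟨⟨s.isDerivation, s'.isDerivation, disjoint_locs hρ s h.left s' h.right h.disjoint_E,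
    h.mem_concl hp s ha hb, h.symm.mem_concl hp' s' hb ha, ?_⟩, ?_, ?_, ?_, ?_, ?_⟩
  · rw [← hlc, Finset.mem_union, not_or]
    exact ⟨s.tag_notMem_locs hρ h.left fun h => hcQ (Or.inl h),
      s'.tag_notMem_locs hρ h.right fun h => hcQ (Or.inr h)⟩
  · have i := nonempty_iso_addLink hρ hp hc hct
    rw [hr, hl] at i
    obtain ⟨i⟩ := i
    obtain ⟨k⟩ := h.nonempty_iso
    obtain ⟨j⟩ := s.iso
    obtain ⟨j'⟩ := s'.iso
    exact ⟨i.symm.trans ((k.symm.trans (j.disjUnion j')).addLink _ _ _ _)⟩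
  · intro m hm
    rcases Finset.mem_insert.1 hm with rfl | hm
    · exact ⟨c, Or.inl hlc.symm⟩
    rcases Finset.mem_union.1 hm with hm | hm
    · obtain ⟨e, -, he⟩ := s.exists_mem_newLocs h.left hm
      exact ⟨e, he⟩
    · obtain ⟨e, -, he⟩ := s'.exists_mem_newLocs h.right hm
      exact ⟨e, he⟩
  · intro A
    change A ∈ {_} ∪ (π.concl \ {ρ.type a}) ∪ (π'.concl \ {ρ.type b}) ↔ _
    rw [Set.union_assoc, Set.mem_union, h.mem_concl_diff_union_iff hρ hp s s' ha hb, ← hl]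
    constructor
    · rintro (rfl | ⟨e, -, he⟩)
      · exact ⟨c, hct, rfl⟩
      · exact ⟨e, he⟩
    · rintro ⟨e, he, rfl⟩
      by_cases hec : e = c
      · exact Or.inl (by rw [hec]; rfl)
      · exact Or.inr ⟨e, fun h => hec ((hsrc e).1 h), he, rfl⟩
  · exact fun hc => ⟨s.hypFree (h.left.isClosed hc), s'.hypFree (h.right.isClosed hc)⟩
  · exact fun hc => ⟨s.mixFree (h.isConnected hp ha hb hc),
      s'.mixFree (h.symm.isConnected hp' hb ha hc)⟩

/-- A correctness graph retains a single premise of the ⅋-vertex `v`, so a single edge `g` joins the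
rest to `v`. -/
theorem isConnected_remove (hterm : ∀ c, ρ.src c = some v → ρ.tgt c = none)
    (hr : ρ.rule v = .parr) (hab : a ≠ b) (hp : ρ.premises v = {a, b}) (hc : ρ.IsConnected) :
    (ρ.remove v).IsConnected := by
  obtain ⟨S, hS, hcard⟩ := hc
  have hmem : ∀ e, ρ.tgt e = some v ↔ e = a ∨ e = b := by
    intro e
    change e ∈ ρ.premises v ↔ _
    rw [hp]
    rfl
  have hsrc : ∀ e, ρ.tgt e = some v → ρ.src e ≠ some v := by
    intro e he h
    have := hterm e h
    rw [he] at this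
    cases this
  obtain ⟨e, ⟨heS, hev⟩, hu⟩ := hS.2 v hr
  obtain ⟨g, hg, hgS⟩ : ∃ g, ρ.tgt g = some v ∧ ∀ e, ρ.tgt e = some v → e ∉ S → e = g := by
    rcases (hmem e).1 hev with rfl | rfl
    · refine ⟨b, (hmem b).2 (Or.inr rfl), fun f hf hfS => ?_⟩
      rcases (hmem f).1 hf with rfl | rfl
      · exact (hfS heS).elim
      · rfl
    · refine ⟨a, (hmem a).2 (Or.inl rfl), fun f hf hfS => ?_⟩
      rcases (hmem f).1 hf with rfl | rfl
      · rfl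
      · exact (hfS heS).elim
  refine (isPart_remove hterm).isConnected hS hcard (hsrc g hg) ?_
  intro f _ w hw hf hfS
  obtain rfl : w = v := by simpa using hw
  exact hgS f hf hfS

theorem Sequentializes.parr (hρ : ρ.IsProofStructure)
    (hterm : ∀ c, ρ.src c = some v → ρ.tgt c = none)
    (hr : ρ.rule v = .parr) (hab : a ≠ b) (hp : ρ.premises v = {a, b}) {c : ρ.E}
    (hc : ρ.conclusions v = {c}) {l : ℕ} (hl : ρ.type c = .parr l (ρ.type a) (ρ.type b))
    (s : (ρ.remove v).Sequentializes π) :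
    ρ.Sequentializes (.parr l (ρ.type a) (ρ.type b) π) := by
  have hpart := isPart_remove hterm
  have hsrc : ∀ e, ρ.src e = some v ↔ e = c := by
    intro e
    change e ∈ ρ.conclusions v ↔ _
    rw [hc]
    rfl
  have hmem : ∀ e, ρ.tgt e = some v ↔ e = a ∨ e = b := by
    intro e
    change e ∈ ρ.premises v ↔ _
    rw [hp]
    rfl
  have hct := hterm c ((hsrc c).2 rfl)
  have hlc : (ρ.type c).tag = l := by rw [hl]; rfl
  have hprem : ∀ e, ρ.tgt e = some v → ρ.type e ∈ π.concl := by
    intro e he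
    refine s.mem_concl_iff.2 ⟨e, fun h => ?_, ?_, rfl⟩
    · have := hterm e h
      rw [he] at this
      cases this
    · intro w hw
      rw [he] at hw
      cases hw
      simp
  refine ⟨⟨s.isDerivation, hprem a ((hmem a).2 (Or.inl rfl)), hprem b ((hmem b).2 (Or.inr rfl)),
    hρ.type_injective.ne hab, ?_⟩, ?_, ?_, ?_, ?_, ?_⟩
  · rw [← hlc]
    exact s.tag_notMem_locs hρ hpart fun h => h ((hsrc c).2 rfl)
  · have i := nonempty_iso_addLink hρ hp hc hct
    rw [hr, hl] at i
    obtain ⟨i⟩ := i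
    obtain ⟨j⟩ := s.iso
    exact ⟨i.symm.trans (j.addLink _ _ _ _)⟩
  · intro m hm
    rcases Finset.mem_insert.1 hm with rfl | hm
    · exact ⟨c, Or.inl hlc.symm⟩
    · obtain ⟨e, -, he⟩ := s.exists_mem_newLocs hpart hm
      exact ⟨e, he⟩
  · intro A
    have hT : ∀ e ∈ {e | ρ.src e ≠ some v}, e ∈ ({a, b} : Set ρ.E) ↔
        ∃ w, ρ.tgt e = some w ∧ w ∉ {w | w ≠ v} := by
      intro e _
      rw [← hp]
      change ρ.tgt e = some v ↔ _
      simp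
    have h₁ := s.mem_concl_diff_iff hρ hT (A := A)
    rw [Set.image_pair] at h₁
    change A ∈ {_} ∪ (π.concl \ {ρ.type a, ρ.type b}) ↔ _
    rw [Set.mem_union, h₁, ← hl]
    constructor
    · rintro (rfl | ⟨e, -, he⟩)
      · exact ⟨c, hct, rfl⟩
      · exact ⟨e, he⟩
    · rintro ⟨e, he, rfl⟩
      by_cases hec : e = c
      · exact Or.inl (by rw [hec]; rfl)
      · exact Or.inr ⟨e, fun h => hec ((hsrc e).1 h), he, rfl⟩
  · exact fun hc => s.hypFree (hpart.isClosed hc)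
  · exact fun hc => s.mixFree (isConnected_remove hterm hr hab hp hc)

end IsSplit

theorem Sequentializes.ax (hρ : ρ.IsProofStructure) {v : ρ.V} (hr : ρ.rule v = .ax) {a b : ρ.E}
    (hab : a ≠ b) (hsrca : ρ.src a = some v) (hsrcb : ρ.src b = some v)
    (hd : (ρ.type a).Dual (ρ.type b)) (hta : ρ.tgt a = none) (htb : ρ.tgt b = none)
    (hV : ∀ w, w = v) (hE : ∀ e, e = a ∨ e = b) :
    ρ.Sequentializes (.ax (ρ.type a) (ρ.type b)) := by
  have hla : ∀ l ∈ (ρ.type a).locs, l ∈ ρ.newLocs a := fun l hl =>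
    Or.inr ⟨Or.inr ⟨v, hsrca, hr⟩, hl⟩
  have hlb : ∀ l ∈ (ρ.type b).locs, l ∈ ρ.newLocs b := fun l hl =>
    Or.inr ⟨Or.inr ⟨v, hsrcb, hr⟩, hl⟩
  refine ⟨⟨hd, hρ.wellTagged a, hρ.wellTagged b, ?_⟩, ?_, ?_, ?_, fun _ => trivial,
    fun _ => trivial⟩
  · rw [Finset.disjoint_left]
    exact fun l hl hl' => Set.disjoint_left.1 (hρ.disjoint_locs a b hab) (hla l hl) (hlb l hl')
  · let fE : Bool → ρ.E := fun x => if x then a else b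
    have hfE : fE.Bijective := by
      refine ⟨?_, fun e => ?_⟩
      · rintro (_ | _) (_ | _) h
        · rfl
        · exact (hab h.symm).elim
        · exact (hab h).elim
        · rfl
      · rcases hE e with rfl | rfl
        · exact ⟨true, rfl⟩
        · exact ⟨false, rfl⟩
    have hfV : (fun _ : Unit => v).Bijective :=
      ⟨fun _ _ _ => rfl, fun w => ⟨(), (hV w).symm⟩⟩
    refine ⟨Iso.symm ⟨Equiv.ofBijective _ hfV, Equiv.ofBijective fE hfE, ?_, ?_, ?_, ?_⟩⟩
    · rintro (_ | _)
      · exact hsrcb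
      · exact hsrca
    · rintro (_ | _)
      · exact htb
      · exact hta
    · exact fun _ => hr
    · rintro (_ | _) <;> rfl
  · intro l hl
    rcases Finset.mem_union.1 hl with hl | hl
    · exact ⟨a, hla l hl⟩
    · exact ⟨b, hlb l hl⟩
  · intro A
    change A ∈ {_, _} ↔ _
    rw [Set.mem_insert_iff, Set.mem_singleton_iff]
    constructor
    · rintro (rfl | rfl)
      · exact ⟨a, hta, rfl⟩
      · exact ⟨b, htb, rfl⟩
    · rintro ⟨e, -, rfl⟩
      rcases hE e with rfl | rfl
      · exact Or.inl rfl
      · exact Or.inr rfl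

theorem Sequentializes.hyp (hρ : ρ.IsProofStructure) [IsEmpty ρ.V] {a : ρ.E}
    (hE : ∀ e, e = a) : ρ.Sequentializes (.hyp (ρ.type a)) := by
  have hnone : ∀ o : Option ρ.V, o = none := fun o => by
    rcases o with _ | v
    · rfl
    · exact isEmptyElim v
  refine ⟨hρ.wellTagged a, ?_, ?_, ?_, ?_, fun _ => trivial⟩
  · have hfE : (fun _ : Unit => a).Bijective :=
      ⟨fun _ _ _ => rfl, fun e => ⟨(), (hE e).symm⟩⟩
    exact ⟨Iso.symm ⟨Equiv.equivOfIsEmpty Empty ρ.V, Equiv.ofBijective _ hfE, fun _ => hnone _,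
      fun _ => hnone _, fun v => v.elim, fun _ => rfl⟩⟩
  · exact fun l hl => ⟨a, Or.inr ⟨Or.inl (hnone _), hl⟩⟩
  · intro A
    change A ∈ {_} ↔ _
    rw [Set.mem_singleton_iff]
    constructor
    · rintro rfl
      exact ⟨a, hnone _, rfl⟩
    · rintro ⟨e, -, rfl⟩
      rw [hE e]
  · exact fun hc => (hc a (hnone _)).elim

theorem Sequentializes.mix₀ [IsEmpty ρ.V] [IsEmpty ρ.E] : ρ.Sequentializes .mix₀ := by
  refine ⟨trivial, ?_, ?_, ?_, fun _ => trivial, ?_⟩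
  · exact ⟨⟨Equiv.equivOfIsEmpty ρ.V Empty, Equiv.equivOfIsEmpty ρ.E Empty, isEmptyElim, isEmptyElim,
      isEmptyElim, isEmptyElim⟩⟩
  · intro l hl
    change l ∈ (∅ : Finset ℕ) at hl
    simp at hl
  · intro A
    change A ∈ (∅ : Set _) ↔ _
    simp
  -- The empty graph has no component, so it is not connected.
  · rintro ⟨S, -, hS⟩
    unfold PartialGraph.numComponents at hS
    rw [Nat.card_eq_one_iff_unique] at hS
    obtain ⟨x⟩ := hS.2
    induction x using Quot.ind with
    | mk x => rcases x with x | x <;> exact isEmptyElim x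

theorem card_restrict_lt [Finite ρ.V] [Finite ρ.E] {P : Set ρ.V} {Q : Set ρ.E} {x : ρ.V ⊕ ρ.E}
    (hx : ¬ Sum.elim P Q x) :
    Nat.card (ρ.restrict P Q).V + Nat.card (ρ.restrict P Q).E < Nat.card ρ.V + Nat.card ρ.E := by
  change Nat.card P + Nat.card Q < _
  rcases x with v | e
  · exact Nat.add_lt_add_of_lt_of_le (Finite.card_subtype_lt (p := (· ∈ P)) hx)
      (Finite.card_subtype_le (· ∈ Q))
  · exact Nat.add_lt_add_of_le_of_lt (Finite.card_subtype_le (· ∈ P))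
      (Finite.card_subtype_lt (p := (· ∈ Q)) hx)

/-! ### The induction. -/

/-- Sequentialization of proof nets. -/
theorem IsProofNet.exists_sequentializes (n : ℕ) : ∀ (ρ : LabeledGraph Atom), ρ.IsProofNet →
    Nat.card ρ.V + Nat.card ρ.E = n → ∃ π, ρ.Sequentializes π := by
  induction n using Nat.strong_induction_on with
  | _ n ih =>
  intro ρ hρ hn
  have hps := hρ.isProofStructure
  have := hps.finite_V
  have := hps.finite_E
  have IH : ∀ {P Q}, ρ.IsPart P Q → ∀ x, ¬ Sum.elim P Q x →
      ∃ π, (ρ.restrict P Q).Sequentializes π := fun {P Q} h x hx =>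
    ih _ (hn ▸ card_restrict_lt hx) _ (h.isProofNet hρ) rfl
  by_cases hmix : ∃ P Q, ρ.IsComponentUnion P Q ∧ (∃ x, Sum.elim P Q x) ∧ ∃ x, ¬ Sum.elim P Q x
  · obtain ⟨P, Q, h, ⟨x, hx⟩, y, hy⟩ := hmix
    obtain ⟨π, s⟩ := IH h.isPart y hy
    obtain ⟨π', s'⟩ := IH h.compl.isPart x (by
      rcases x with x | x
      · exact fun h => h hx
      · exact fun h => h hx)
    exact ⟨_, .mix hps h s s' (h.not_isConnected hx hy)⟩
  · have hall : ∀ P Q, ρ.IsComponentUnion P Q → (∃ x, Sum.elim P Q x) → ∀ x, Sum.elim P Q x := by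
      intro P Q h hx y
      by_contra hy
      exact hmix ⟨P, Q, h, hx, y, hy⟩
    rcases isEmpty_or_nonempty ρ.V with hV | hV
    · rcases isEmpty_or_nonempty ρ.E with hE | ⟨⟨a⟩⟩
      · exact ⟨_, .mix₀⟩
      -- Without vertices each edge is a component, so there is only one edge.
      · have := hall ∅ {a} ⟨fun _ v => isEmptyElim v, fun _ v => isEmptyElim v⟩ ⟨.inr a, rfl⟩
        exact ⟨_, .hyp hps (a := a) fun e => this (.inr e)⟩
    · obtain ⟨v, hsplit, hterm⟩ := hρ.exists_terminal_splitting hV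
      have hloc := hps.local_constraint v
      unfold LocalConstraint at hloc
      rcases hr : ρ.rule v <;> simp only [hr] at hloc
      · obtain ⟨hp, a, b, hab, hc, hd⟩ := hloc
        have hmem : ∀ e, ρ.src e = some v ↔ e = a ∨ e = b := by
          intro e
          change e ∈ ρ.conclusions v ↔ _
          rw [hc]
          rfl
        have hsrca := (hmem a).2 (Or.inl rfl)
        have hsrcb := (hmem b).2 (Or.inr rfl)
        -- A terminal `ax`-vertex and its conclusions form a component, hence the whole graph.
        have hcomp : ρ.IsComponentUnion {v} {a, b} := by
          refine ⟨?_, ?_⟩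
          · intro e w hw
            change (e = a ∨ e = b) ↔ w = v
            rw [← hmem, hw, Option.some_inj]
          · intro e w hw
            change (e = a ∨ e = b) ↔ w = v
            rw [← hmem]
            constructor
            · intro h
              have := hterm e h
              rw [hw] at this
              cases this
            · rintro rfl
              have : e ∈ ρ.premises w := hw
              rw [hp] at this
              exact this.elim
        have hall' := hall _ _ hcomp ⟨.inl v, rfl⟩
        exact ⟨_, .ax hps hr hab hsrca hsrcb hd (hterm a hsrca) (hterm b hsrcb)
          (fun w => hall' (.inl w)) (fun e => hall' (.inr e))⟩
      · obtain ⟨hc, a, b, hab, hp, hd⟩ := hloc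
        have ha : a ∈ ρ.premises v := by simp [hp]
        have hb : b ∈ ρ.premises v := by simp [hp]
        obtain ⟨P, P', Q, Q', h, haQ, hbQ⟩ :=
          hsplit.exists_isSplit (by simp [hr]) hterm hab ha hb
        obtain ⟨π, s⟩ := IH h.left (.inr b) (Set.disjoint_right.1 h.disjoint_E hbQ)
        obtain ⟨π', s'⟩ := IH h.right (.inr a) (Set.disjoint_left.1 h.disjoint_E haQ)
        exact ⟨_, .cut hps h hr hp hc hd s s' haQ hbQ⟩
      · obtain ⟨a, b, c, l, hab, hp, hc, hl⟩ := hloc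
        have ha : a ∈ ρ.premises v := by simp [hp]
        have hb : b ∈ ρ.premises v := by simp [hp]
        have hcv : c ∈ ρ.conclusions v := by simp [hc]
        obtain ⟨P, P', Q, Q', h, haQ, hbQ⟩ :=
          hsplit.exists_isSplit (by simp [hr]) hterm hab ha hb
        obtain ⟨π, s⟩ := IH h.left (.inr b) (Set.disjoint_right.1 h.disjoint_E hbQ)
        obtain ⟨π', s'⟩ := IH h.right (.inr a) (Set.disjoint_left.1 h.disjoint_E haQ)
        exact ⟨_, .tensor hps h hr hp hc (hterm c hcv) hl s s' haQ hbQ⟩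
      · obtain ⟨a, b, c, l, hab, hp, hc, hl⟩ := hloc
        obtain ⟨π, s⟩ := IH (isPart_remove hterm) (.inl v) (fun h => h rfl)
        exact ⟨_, .parr hps hterm hr hab hp hc hl s⟩

end LabeledGraph

end ProofNet

theorem mainTheorem6 {Atom : Type*} (ρ : ProofNet.LabeledGraph Atom) (hρ : ρ.IsProofNet) :
    -- a proof net with at least one vertex has a splitting vertex
    (Nonempty ρ.V → ∃ v, ρ.IsSplitting v) ∧
    -- sequentialization
    (∃ π : ProofNet.DerivationTree Atom, π.IsDerivation ∧ Nonempty (ρ.Iso π.deseq)) ∧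
    -- closed sequentialization
    (ρ.IsClosed → ∃ π : ProofNet.DerivationTree Atom,
      π.IsDerivation ∧ π.HypFree ∧ Nonempty (ρ.Iso π.deseq)) ∧
    -- connected sequentialization
    (ρ.IsConnected → ∃ π : ProofNet.DerivationTree Atom,
      π.IsDerivation ∧ π.MixFree ∧ Nonempty (ρ.Iso π.deseq)) ∧
    -- closed connected sequentialization
    (ρ.IsClosed → ρ.IsConnected → ∃ π : ProofNet.DerivationTree Atom,
      π.IsDerivation ∧ π.HypFree ∧ π.MixFree ∧ Nonempty (ρ.Iso π.deseq)) := by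
  obtain ⟨π, h⟩ := ProofNet.LabeledGraph.IsProofNet.exists_sequentializes _ ρ hρ rfl
  refine ⟨fun hV => ?_, ⟨π, h.isDerivation, h.iso⟩,
    fun hc => ⟨π, h.isDerivation, h.hypFree hc, h.iso⟩,
    fun hc => ⟨π, h.isDerivation, h.mixFree hc, h.iso⟩,
    fun hc hc' => ⟨π, h.isDerivation, h.hypFree hc, h.mixFree hc', h.iso⟩⟩
  obtain ⟨v, hv, -⟩ := hρ.exists_terminal_splitting hV
  exact ⟨v, hv⟩
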